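/- **Theorem 1.** Let $Q=(0,\infty)\times(0,\infty)$ and let $u_0,g_0:[0,\infty)\to\mathbb C$ and $f:\overline Q\to\mathbb C$ be such that - $u_0\in\mathcal S([0,\infty))$, i.e. $u_0\in C^\infty([0,\infty))$ and $\sup_{x\ge 0}|x^\ell u_0^{(k)}(x)|<\infty$ for all integers $k,\ell\ge 0$; - $g_0\in C^\infty([0,\infty))$; - $f\in C^\infty(\overline Q)$, and $f(\cdot,t)$ with its $t$-derivatives is Schwartz in $x$ uniformly for $t$ in compact sets, i.e. $\sup\{|x^\ell\partial_x^k\partial_t^m f(x,t)| : x\ge 0,\ 0\le t\le T\}<\infty$ for all $T>0$ and all integers $k,m,\ell\ge 0$. Put $\omega(\lambda)=-i\lambda^3$, $\alpha=e^{2\pi i/3}$, and, for $\operatorname{Im}\lambda\le 0$, $$\hat u_0(\lambda)=\int_0^\infty e^{-i\lambda y}u_0(y)\,dy,\qquad \hat f(\lambda,t)=\int_0^\infty e^{-i\lambda y}f(y,t)\,dy,$$ $$\tilde g_0(w,t)=\int_0^t e^{w\tau}g_0(\tau)\,d\tau,\qquad \tilde f(\lambda,w,t)=\int_0^t e^{w\tau}\hat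 f(\lambda,\tau)\,d\tau \qquad (w\in\mathbb C).$$ Let $\Gamma=\{\xi+i\eta:\eta=\sqrt3|\xi|\}$ be the positively oriented boundary of $\{\lambda:\operatorname{Im}\lambda\ge0,\ \operatorname{Re}\omega(\lambda)\le0\}$ (traversed from $\infty e^{2\pi i/3}$ through $0$ to $\infty e^{i\pi/3}$). For $x,t>0$ let $U(x,t)$ be given by the unified transform method formula for the problem $U_t+U_{xxx}=f$ in $Q$, $U(x,0^+)=u_0(x)$, $U(0^+,t)=g_0(t)$: $$\begin{aligned}2\pi U(x,t)={}&\int_{-\infty}^{\infty}e^{i\lambda x-\omega(\lambda)t}\hat u_0(\lambda)\,d\lambda+\int_\Gamma e^{i\lambda x-\omega(\lambda)t}\left[\alpha\hat u_0(\alpha\lambda)+\alpha^2\hat u_0(\alpha^2\lambda)\right]d\lambda\\&-\int_\Gamma e^{i\lambda x-\omega(\lambda)t}\,3\lambda^2\,\tilde g_0(\omega(\lambda),t)\,d\lambda+\int_{-\infty}^{\infty}e^{i\lambda x-\omega(\lambda)t}\tilde f(\lambda,\omega(\lambda),t)\,d\lambda\\&+\int_\Gamma e^{i\lambda x-\omega(\lambda)t}\left[\alpha\tilde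 f(\alpha\lambda,\omega(\lambda),t)+\alpha^2\tilde f(\alpha^2\lambda,\omega(\lambda),t)\right]d\lambda,\end{aligned}$$ the integrals over $\mathbb R$ being improper integrals $\lim_{a\to-\infty,\,b\to+\infty}\int_a^b$. Then all these integrals converge for $x,t>0$ (those over $\Gamma$ absolutely), $U\in C^\infty(Q)$, and for every $T_0>0$ and all integers $k,m,\ell\ge0$ $$\lim_{x\to+\infty}x^\ell\,\partial_x^k\partial_t^mU(x,t)=0\quad\text{uniformly for }0<t\le T_0 .$$ Moreover, for every $x_0>0$, $$\sup\left\{\left|x^\ell\,\partial_x^k\partial_t^mU(x,t)\right| : x\ge x_0,\ 0<t\le T_0\right\}<\infty .$$ -/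

import Mathlib

open Set Filter Topology MeasureTheory
open scoped ContDiff

namespace LinearKdV

noncomputable section

/-- The Schwartz class `𝓢([0,∞))`: smooth up to the endpoint `0` (one-sided derivatives there),
every derivative decaying faster than any power of `x`. -/
structure IsSchwartzHalfLine (u : ℝ → ℂ) : Prop where
  smooth : ContDiffOn ℝ ∞ u (Ici 0)
  decay : ∀ k l : ℕ, ∃ C : ℝ, ∀ x : ℝ, 0 ≤ x →
    ‖(x : ℂ) ^ l * iteratedDerivWithin k u (Ici 0) x‖ ≤ C

/-- Forcing terms: `f = f(x,t)` is smooth on the closed quarter-plane, and `f(·,t)` together with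
its `t`-derivatives is in `𝓢([0,∞))` with respect to `x`, uniformly for `t` in compact subsets of
`[0,∞)`. -/
structure IsSchwartzForcing (f : ℝ → ℝ → ℂ) : Prop where
  smooth : ContDiffOn ℝ ∞ (fun p : ℝ × ℝ => f p.1 p.2) (Ici 0 ×ˢ Ici 0)
  decay : ∀ (T : ℝ) (k m l : ℕ), ∃ C : ℝ, ∀ x t : ℝ, 0 ≤ x → 0 ≤ t → t ≤ T →
    ‖(x : ℂ) ^ l * iteratedDerivWithin k
      (fun y => iteratedDerivWithin m (fun s => f y s) (Ici 0) t) (Ici 0) x‖ ≤ C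

/-- `ω(z) = -i z³`. -/
def disp (z : ℂ) : ℂ := -Complex.I * z ^ 3

/-- The half-line Fourier transform `û(z) = ∫₀^∞ e^{-izy} u(y) dy`, used for `Im z ≤ 0`. -/
def hat (u : ℝ → ℂ) (z : ℂ) : ℂ :=
  ∫ y in Ioi (0 : ℝ), Complex.exp (-Complex.I * z * y) * u y

/-- `g̃(w,t) = ∫₀ᵗ e^{wτ} g(τ) dτ`. -/
def gTilde (g : ℝ → ℂ) (w : ℂ) (t : ℝ) : ℂ :=
  ∫ τ in (0 : ℝ)..t, Complex.exp (w * τ) * g τ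

/-- `f̃(z,w,t) = ∫₀ᵗ e^{wτ} f̂(z,τ) dτ`, where `f̂(z,τ)` is the transform of `f(·,τ)`. -/
def fTilde (f : ℝ → ℝ → ℂ) (z w : ℂ) (t : ℝ) : ℂ :=
  ∫ τ in (0 : ℝ)..t, Complex.exp (w * τ) * hat (fun y => f y τ) z

/-- `α = e^{2πi/3}`. -/
def alpha : ℂ := Complex.exp (2 * Real.pi * Complex.I / 3)

/-- `e^{iπ/3}`, the direction of the right ray of `Γ`. -/
def rayR : ℂ := Complex.exp (Real.pi * Complex.I / 3)

/-- `e^{2πi/3}`, the direction of the left ray of `Γ`. -/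
def rayL : ℂ := Complex.exp (2 * Real.pi * Complex.I / 3)

/-- The (possibly only conditionally convergent) improper integral of `F` over `ℝ` converges: its
integrals over `[a,b]` have a limit as `a → -∞` and `b → +∞` independently. -/
def ConvergesOnLine (F : ℝ → ℂ) : Prop :=
  LocallyIntegrable F ∧ ∃ I : ℂ, Tendsto (fun p : ℝ × ℝ => ∫ s in p.1..p.2, F s)
    (atBot ×ˢ atTop) (𝓝 I)

/-- The improper integral `∫_{-∞}^{∞} F(s) ds`. -/
def lineIntegral (F : ℝ → ℂ) : ℂ :=
  limUnder (atBot ×ˢ atTop) (fun p : ℝ × ℝ => ∫ s in p.1..p.2, F s)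

/-- Absolute convergence of the integral of `F` over
`Γ = ∂{z : Im z ≥ 0, Re ω(z) ≤ 0} = {ξ + iη : η = √3 |ξ|}`. -/
def ConvergesOnGamma (F : ℂ → ℂ) : Prop :=
  IntegrableOn (fun r : ℝ => F (r * rayR)) (Ioi 0) ∧
    IntegrableOn (fun r : ℝ => F (r * rayL)) (Ioi 0)

/-- The contour integral `∫_Γ F(z) dz`, where `Γ` is oriented as the positively oriented boundary
of `{Im z ≥ 0, Re ω(z) ≤ 0}`: from infinity to `0` along the ray `arg z = 2π/3`, then from `0` to
infinity along the ray `arg z = π/3`. -/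
def gammaIntegral (F : ℂ → ℂ) : ℂ :=
  (∫ r in Ioi (0 : ℝ), F (r * rayR) * rayR) - ∫ r in Ioi (0 : ℝ), F (r * rayL) * rayL

/-- `e^{izx - ω(z)t}`. -/
def kernel (x t : ℝ) (z : ℂ) : ℂ := Complex.exp (Complex.I * z * x - disp z * t)

/-- Integrand of `𝕀_ℝ`. -/
def initialLine (u₀ : ℝ → ℂ) (x t : ℝ) (z : ℂ) : ℂ := kernel x t z * hat u₀ z

/-- Integrand of `𝕀_Γ`. -/
def initialGamma (u₀ : ℝ → ℂ) (x t : ℝ) (z : ℂ) : ℂ :=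
  kernel x t z * (alpha * hat u₀ (alpha * z) + alpha ^ 2 * hat u₀ (alpha ^ 2 * z))

/-- Integrand of `𝕀_g`. -/
def boundaryGamma (g₀ : ℝ → ℂ) (x t : ℝ) (z : ℂ) : ℂ :=
  kernel x t z * (3 * z ^ 2 * gTilde g₀ (disp z) t)

/-- Integrand of `Φ_ℝ`. -/
def forcingLine (f : ℝ → ℝ → ℂ) (x t : ℝ) (z : ℂ) : ℂ :=
  kernel x t z * fTilde f z (disp z) t

/-- Integrand of `Φ_Γ`. -/
def forcingGamma (f : ℝ → ℝ → ℂ) (x t : ℝ) (z : ℂ) : ℂ :=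
  kernel x t z * (alpha * fTilde f (alpha * z) (disp z) t +
    alpha ^ 2 * fTilde f (alpha ^ 2 * z) (disp z) t)

/-- The unified-transform solution of `U_t + U_xxx = f`, `U(x,0) = u₀(x)`, `U(0,t) = g₀(t)`:
`2π U = 𝕀_ℝ + 𝕀_Γ - 𝕀_g + Φ_ℝ + Φ_Γ`, for `x > 0` and `t > 0`. -/
def utmSolution (u₀ g₀ : ℝ → ℂ) (f : ℝ → ℝ → ℂ) (x t : ℝ) : ℂ :=
  (lineIntegral (fun s => initialLine u₀ x t s) + gammaIntegral (initialGamma u₀ x t)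
    - gammaIntegral (boundaryGamma g₀ x t)
    + lineIntegral (fun s => forcingLine f x t s) + gammaIntegral (forcingGamma f x t))
    / (2 * Real.pi)

/-- All five integrals in the formula for `U(x,t)` converge. -/
def UTMConverges (u₀ g₀ : ℝ → ℂ) (f : ℝ → ℝ → ℂ) (x t : ℝ) : Prop :=
  ConvergesOnLine (fun s => initialLine u₀ x t s) ∧ ConvergesOnGamma (initialGamma u₀ x t) ∧
    ConvergesOnGamma (boundaryGamma g₀ x t) ∧ ConvergesOnLine (fun s => forcingLine f x t s) ∧
    ConvergesOnGamma (forcingGamma f x t)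

/-- `∂_x^k ∂_t^m U (x,t)`. -/
def mixedDeriv (k m : ℕ) (U : ℝ → ℝ → ℂ) (x t : ℝ) : ℂ :=
  iteratedDeriv k (fun y => iteratedDeriv m (fun s => U y s) t) x

end

end LinearKdV

/-! Up to polynomial or constant factors, each of the five integrands is `e^{izx} E(z,t)`, where `E
= evolve κ μ A` solves `E_t + ω(z) E = μ A` with `E(z,0) = κ A(z,0)`. Initial data correspond to
`(κ, μ) = (1, 0)`; the boundary datum and the forcing correspond to `(0, 1)`. On `ℝ` and on `Γ` the
symbol `ω` is purely imaginary, so `E` inherits the polynomial bounds of `A`. Each derivative along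
a ray costs two powers of `z` (from `ω' ~ z²`), each `t`-derivative three (`IsSymbol.evolve`,
`IsAmplitude.evolve`).

On `Γ` the factor `e^{izx}` decays exponentially for `x ≥ x₀ > 0`, so differentiation under the
integral is free. Powers of `x` are gained by integrating by parts along the two rays: the boundary
terms at the common endpoint `0` cancel (`IsSymbol.pairIntegral_decay`, `IsAmplitude.decaysUpTo`).

On `ℝ` there is no exponential decay, and a half-line transform is in general only `O(1/z)`.
Integration by parts in `y` gives `(1 + iz) û = u(0) + (u + u')^`; the zero `z = i` of the factor
lies above `Γ`, out of the way. In the term with the boundary value, the evolved datum is entire in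
`z` and bounded where `Re ω ≥ 0`, i.e. between `ℝ` and `Γ`, so Jordan's lemma moves this term to `Γ`
(`tendsto_line_trace`). The other term has the original form with one more factor `(1 + iz)⁻¹`.
After enough rounds it converges absolutely together with all the derivatives wanted, and the
argument for pairs of rays applies to `ℝ` itself, seen as the rays in the directions `1` and `-1`
(`IsDataFamily.exists_line_decay`).

The number of rounds depends on how many derivatives and powers of `x` are wanted. Hence all
estimates are stated to a finite order `M` (`DecaysUpTo`), which is arbitrary at the end. -/

namespace LinearKdV

section

/-! ### Functions on the quarter-plane with finitely many decaying mixed derivatives -/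

/-- `V` has mixed partial derivatives up to order `M + 1` in each variable, all of which decay at
least like `x ^ (-M)`, uniformly for `t` in bounded subsets of `(0, ∞)`. -/
def DecaysUpTo (M : ℕ) (V : ℝ → ℝ → ℂ) : Prop :=
  ∃ W : ℕ → ℕ → ℝ → ℝ → ℂ,
    (∀ x t, 0 < x → 0 < t → W 0 0 x t = V x t) ∧
    (∀ k m, k ≤ M → m ≤ M → ∀ x t, 0 < x → 0 < t →
      HasDerivAt (fun y => W k m y t) (W (k + 1) m x t) x ∧
      HasDerivAt (fun s => W k m x s) (W k (m + 1) x t) t) ∧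
    ∀ k m l, k ≤ M + 1 → m ≤ M + 1 → l ≤ M → ∀ x₀ T₀ : ℝ, 0 < x₀ → 0 < T₀ →
      ∃ C : ℝ, ∀ x t : ℝ, x₀ ≤ x → 0 < t → t ≤ T₀ → ‖(x : ℂ) ^ l * W k m x t‖ ≤ C

namespace DecaysUpTo

variable {M : ℕ} {V V₁ V₂ : ℝ → ℝ → ℂ}

lemma congr (h : DecaysUpTo M V₁) (hV : ∀ x t, 0 < x → 0 < t → V₁ x t = V₂ x t) :
    DecaysUpTo M V₂ := by
  obtain ⟨W, h0, h1, h2⟩ := h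
  exact ⟨W, fun x t hx ht => (h0 x t hx ht).trans (hV x t hx ht), h1, h2⟩

lemma add (h₁ : DecaysUpTo M V₁) (h₂ : DecaysUpTo M V₂) :
    DecaysUpTo M (fun x t => V₁ x t + V₂ x t) := by
  obtain ⟨W, h0, h1, h2⟩ := h₁
  obtain ⟨W', h0', h1', h2'⟩ := h₂
  refine ⟨fun k m x t => W k m x t + W' k m x t, fun x t hx ht => ?_, ?_, ?_⟩
  · simp only [h0 x t hx ht, h0' x t hx ht]
  · intro k m hk hm x t hx ht
    exact ⟨(h1 k m hk hm x t hx ht).1.add (h1' k m hk hm x t hx ht).1,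
      (h1 k m hk hm x t hx ht).2.add (h1' k m hk hm x t hx ht).2⟩
  · intro k m l hk hm hl x₀ T₀ hx₀ hT₀
    obtain ⟨C, hC⟩ := h2 k m l hk hm hl x₀ T₀ hx₀ hT₀
    obtain ⟨C', hC'⟩ := h2' k m l hk hm hl x₀ T₀ hx₀ hT₀
    refine ⟨C + C', fun x t hx ht htT => ?_⟩
    rw [mul_add]
    exact norm_add_le_of_le (hC x t hx ht htT) (hC' x t hx ht htT)

lemma const_mul (c : ℂ) (h : DecaysUpTo M V) : DecaysUpTo M (fun x t => c * V x t) := by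
  obtain ⟨W, h0, h1, h2⟩ := h
  refine ⟨fun k m x t => c * W k m x t, fun x t hx ht => ?_, ?_, ?_⟩
  · simp only [h0 x t hx ht]
  · intro k m hk hm x t hx ht
    exact ⟨(h1 k m hk hm x t hx ht).1.const_mul c, (h1 k m hk hm x t hx ht).2.const_mul c⟩
  · intro k m l hk hm hl x₀ T₀ hx₀ hT₀
    obtain ⟨C, hC⟩ := h2 k m l hk hm hl x₀ T₀ hx₀ hT₀
    refine ⟨‖c‖ * C, fun x t hx ht htT => ?_⟩
    rw [mul_left_comm, norm_mul]
    exact mul_le_mul_of_nonneg_left (hC x t hx ht htT) (norm_nonneg _)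

end DecaysUpTo

/-- A function on the quarter-plane with locally bounded first partial derivatives is
continuous. -/
lemma continuousOn_quarter_of_bounded_partials {F F₁ F₂ : ℝ → ℝ → ℂ}
    (h₁ : ∀ x t, 0 < x → 0 < t → HasDerivAt (fun y => F y t) (F₁ x t) x)
    (h₂ : ∀ x t, 0 < x → 0 < t → HasDerivAt (fun s => F x s) (F₂ x t) t)
    (b₁ : ∀ x₀ T₀ : ℝ, 0 < x₀ → 0 < T₀ →
      ∃ C : ℝ, ∀ x t : ℝ, x₀ ≤ x → 0 < t → t ≤ T₀ → ‖F₁ x t‖ ≤ C)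
    (b₂ : ∀ x₀ T₀ : ℝ, 0 < x₀ → 0 < T₀ →
      ∃ C : ℝ, ∀ x t : ℝ, x₀ ≤ x → 0 < t → t ≤ T₀ → ‖F₂ x t‖ ≤ C) :
    ContinuousOn (fun p : ℝ × ℝ => F p.1 p.2) (Ioi 0 ×ˢ Ioi 0) := by
  rintro ⟨x, t⟩ ⟨hx : 0 < x, ht : 0 < t⟩
  apply ContinuousAt.continuousWithinAt
  obtain ⟨C₁, hC₁⟩ := b₁ (x / 2) (2 * t) (by positivity) (by positivity)
  obtain ⟨C₂, hC₂⟩ := b₂ (x / 2) (2 * t) (by positivity) (by positivity)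
  have e1 : ∀ᶠ p : ℝ × ℝ in 𝓝 (x, t), x / 2 < p.1 :=
    continuousAt_fst.eventually (lt_mem_nhds (by simpa using half_lt_self hx))
  have e2 : ∀ᶠ p : ℝ × ℝ in 𝓝 (x, t), 0 < p.2 ∧ p.2 < 2 * t :=
    continuousAt_snd.eventually
      (isOpen_Ioo.mem_nhds (show t ∈ Ioo 0 (2 * t) from ⟨ht, by linarith⟩))
  rw [ContinuousAt, tendsto_iff_norm_sub_tendsto_zero]
  refine squeeze_zero' (g := fun p : ℝ × ℝ => C₁ * ‖p.1 - x‖ + C₂ * ‖p.2 - t‖)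
    (Eventually.of_forall fun _ => norm_nonneg _) ?_ ?_
  · filter_upwards [e1, e2] with p hp1 hp2
    have key1 : ‖F p.1 p.2 - F x p.2‖ ≤ C₁ * ‖p.1 - x‖ :=
      (convex_Ici (x / 2)).norm_image_sub_le_of_norm_hasDerivWithin_le
        (f := fun y => F y p.2) (f' := fun y => F₁ y p.2)
        (fun y hy => (h₁ y p.2 (lt_of_lt_of_le (half_pos hx) hy) hp2.1).hasDerivWithinAt)
        (fun y hy => hC₁ y p.2 hy hp2.1 hp2.2.le) (half_le_self hx.le) hp1.le
    have key2 : ‖F x p.2 - F x t‖ ≤ C₂ * ‖p.2 - t‖ :=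
      (convex_Ioc 0 (2 * t)).norm_image_sub_le_of_norm_hasDerivWithin_le
        (f := fun s => F x s) (f' := fun s => F₂ x s)
        (fun s hs => (h₂ x s hx hs.1).hasDerivWithinAt)
        (fun s hs => hC₂ x s (half_le_self hx.le) hs.1 hs.2) ⟨ht, by linarith⟩ ⟨hp2.1, hp2.2.le⟩
    calc ‖F p.1 p.2 - F x t‖ = ‖(F p.1 p.2 - F x p.2) + (F x p.2 - F x t)‖ := by ring_nf
      _ ≤ _ := norm_add_le_of_le key1 key2
  · have : Continuous (fun p : ℝ × ℝ => C₁ * ‖p.1 - x‖ + C₂ * ‖p.2 - t‖) := by fun_prop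
    simpa using this.tendsto (x, t)

/-- Continuous first partial derivatives on the quarter-plane give a total derivative. -/
lemma hasFDerivAt_quarter {F F₁ F₂ : ℝ → ℝ → ℂ}
    (h₁ : ∀ x t, 0 < x → 0 < t → HasDerivAt (fun y => F y t) (F₁ x t) x)
    (h₂ : ∀ x t, 0 < x → 0 < t → HasDerivAt (fun s => F x s) (F₂ x t) t)
    (c₁ : ContinuousOn (fun p : ℝ × ℝ => F₁ p.1 p.2) (Ioi 0 ×ˢ Ioi 0))
    (c₂ : ContinuousOn (fun p : ℝ × ℝ => F₂ p.1 p.2) (Ioi 0 ×ˢ Ioi 0))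
    {p : ℝ × ℝ} (hp : p ∈ (Ioi 0 ×ˢ Ioi 0 : Set (ℝ × ℝ))) :
    HasFDerivAt (fun p : ℝ × ℝ => F p.1 p.2)
      ((ContinuousLinearMap.toSpanSingleton ℝ (F₁ p.1 p.2)).coprod
        (ContinuousLinearMap.toSpanSingleton ℝ (F₂ p.1 p.2))) p := by
  have hQ : (Ioi 0 ×ˢ Ioi 0 : Set (ℝ × ℝ)) ∈ 𝓝 p := (isOpen_Ioi.prod isOpen_Ioi).mem_nhds hp
  have hc : Continuous (fun c : ℂ => ContinuousLinearMap.toSpanSingleton ℝ c) :=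
    (ContinuousLinearMap.toSpanSingletonCLE (𝕜 := ℝ) (E := ℂ)).continuous
  refine (hasStrictFDerivAt_uncurry_coprod
    (f₁ := fun x t => ContinuousLinearMap.toSpanSingleton ℝ (F₁ x t))
    (f₂ := fun x t => ContinuousLinearMap.toSpanSingleton ℝ (F₂ x t))
    ?_ ?_ ?_ ?_).hasFDerivAt
  · filter_upwards [hQ] with q hq
    exact (h₁ q.1 q.2 hq.1 hq.2).hasFDerivAt
  · filter_upwards [hQ] with q hq
    exact (h₂ q.1 q.2 hq.1 hq.2).hasFDerivAt
  · exact hc.continuousAt.comp (c₁.continuousAt hQ)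
  · exact hc.continuousAt.comp (c₂.continuousAt hQ)

namespace DecaysUpTo

variable {M : ℕ} {V : ℝ → ℝ → ℂ}

/-- Bounds up to order `M + 1` make all `W k m` with `k, m ≤ M` continuous, because their first
partials are locally bounded. Continuous partials then give total derivatives, and induction on the
order of smoothness finishes. -/
lemma contDiffOn (h : DecaysUpTo M V) :
    ContDiffOn ℝ M (fun p : ℝ × ℝ => V p.1 p.2) (Ioi 0 ×ˢ Ioi 0) := by
  obtain ⟨W, h0, h1, h2⟩ := h
  have hcont : ∀ k m, k ≤ M → m ≤ M →
      ContinuousOn (fun p : ℝ × ℝ => W k m p.1 p.2) (Ioi 0 ×ˢ Ioi 0) := by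
    intro k m hk hm
    refine continuousOn_quarter_of_bounded_partials
      (fun x t hx ht => (h1 k m hk hm x t hx ht).1) (fun x t hx ht => (h1 k m hk hm x t hx ht).2)
      ?_ ?_
    · intro x₀ T₀ hx₀ hT₀
      simpa using h2 (k + 1) m 0 (by lia) (by lia) (by lia) x₀ T₀ hx₀ hT₀
    · intro x₀ T₀ hx₀ hT₀
      simpa using h2 k (m + 1) 0 (by lia) (by lia) (by lia) x₀ T₀ hx₀ hT₀
  have hopen : IsOpen (Ioi 0 ×ˢ Ioi 0 : Set (ℝ × ℝ)) := isOpen_Ioi.prod isOpen_Ioi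
  -- Each differentiation raises `k` or `m` by one and lowers `j` by one, so both inequalities
  -- persist.
  have main : ∀ j k m : ℕ, k + j ≤ M → m + j ≤ M →
      ContDiffOn ℝ j (fun p : ℝ × ℝ => W k m p.1 p.2) (Ioi 0 ×ˢ Ioi 0) := by
    intro j
    induction j with
    | zero =>
      intro k m hk hm
      rw [Nat.cast_zero, contDiffOn_zero]
      exact hcont k m hk hm
    | succ j ih =>
      intro k m hk hm
      have i1 := ih (k + 1) m (by lia) (by lia)
      have i2 := ih k (m + 1) (by lia) (by lia)
      push_cast
      rw [contDiffOn_succ_iff_hasFDerivWithinAt_of_uniqueDiffOn hopen.uniqueDiffOn]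
      refine ⟨by simp, _, ?_, fun p hp => (hasFDerivAt_quarter
        (fun x t hx ht => (h1 k m (by lia) (by lia) x t hx ht).1)
        (fun x t hx ht => (h1 k m (by lia) (by lia) x t hx ht).2)
        (hcont _ _ (by lia) (by lia)) (hcont _ _ (by lia) (by lia)) hp).hasFDerivWithinAt⟩
      have e : (fun p : ℝ × ℝ =>
          (ContinuousLinearMap.toSpanSingleton ℝ (W (k + 1) m p.1 p.2)).coprod
          (ContinuousLinearMap.toSpanSingleton ℝ (W k (m + 1) p.1 p.2))) =
          fun p : ℝ × ℝ => (ContinuousLinearMap.fst ℝ ℝ ℝ).smulRight (W (k + 1) m p.1 p.2) +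
            (ContinuousLinearMap.snd ℝ ℝ ℝ).smulRight (W k (m + 1) p.1 p.2) := by
        funext p
        ext <;> simp
      rw [e]
      exact (contDiffOn_const.smulRight i1).add (contDiffOn_const.smulRight i2)
  exact (main M 0 0 (by lia) (by lia)).congr fun p hp => (h0 p.1 p.2 hp.1 hp.2).symm

lemma mixedDeriv_bound (h : DecaysUpTo M V) {k m l : ℕ} (hk : k ≤ M) (hm : m ≤ M) (hl : l ≤ M)
    {x₀ T₀ : ℝ} (hx₀ : 0 < x₀) (hT₀ : 0 < T₀) :
    ∃ C : ℝ, ∀ x t : ℝ, x₀ ≤ x → 0 < t → t ≤ T₀ →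
      ‖(x : ℂ) ^ l * mixedDeriv k m V x t‖ ≤ C := by
  obtain ⟨W, h0, h1, h2⟩ := h
  have ht : ∀ j ≤ M, ∀ x t, 0 < x → 0 < t → iteratedDeriv j (fun s => V x s) t = W 0 j x t := by
    intro j
    induction j with
    | zero => intro _ x t hx ht; simp [h0 x t hx ht]
    | succ j ih =>
      intro hj x t hx ht
      rw [iteratedDeriv_succ]
      have : iteratedDeriv j (fun s => V x s) =ᶠ[𝓝 t] fun s => W 0 j x s := by
        filter_upwards [lt_mem_nhds ht] with s hs using ih (by lia) x s hx hs
      rw [this.deriv_eq]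
      exact (h1 0 j (by lia) (by lia) x t hx ht).2.deriv
  have hx : ∀ j ≤ M, ∀ x t, 0 < x → 0 < t → mixedDeriv j m V x t = W j m x t := by
    intro j
    induction j with
    | zero => intro _ x t hx ht'; simpa [mixedDeriv] using ht m hm x t hx ht'
    | succ j ih =>
      intro hj x t hx ht
      rw [mixedDeriv, iteratedDeriv_succ]
      have : iteratedDeriv j (fun y => iteratedDeriv m (fun s => V y s) t)
          =ᶠ[𝓝 x] fun y => W j m y t := by
        filter_upwards [lt_mem_nhds hx] with y hy using ih (by lia) y t hy ht
      rw [this.deriv_eq]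
      exact (h1 j m (by lia) hm x t hx ht).1.deriv
  obtain ⟨C, hC⟩ := h2 k m l (by lia) (by lia) hl x₀ T₀ hx₀ hT₀
  refine ⟨C, fun x t hxx htt htT => ?_⟩
  rw [hx k hk x t (hx₀.trans_le hxx) htt]
  exact hC x t hxx htt htT

/-- The bound with one more power of `x` gives `C / x`; this is why `l < M` is strict. -/
lemma mixedDeriv_tendsto (h : DecaysUpTo M V) {k m l : ℕ} (hk : k ≤ M) (hm : m ≤ M) (hl : l < M)
    {T₀ : ℝ} (hT₀ : 0 < T₀) :
    TendstoUniformlyOn (fun x t : ℝ => (x : ℂ) ^ l * mixedDeriv k m V x t) (fun _ => 0) atTop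
      (Ioc 0 T₀) := by
  obtain ⟨C, hC⟩ := h.mixedDeriv_bound hk hm (l := l + 1) hl one_pos hT₀
  rw [Metric.tendstoUniformlyOn_iff]
  intro ε hε
  filter_upwards [eventually_ge_atTop 1, eventually_gt_atTop (C / ε)] with x hx1 hx2 t ht
  have hx0 : 0 < x := by linarith
  have := hC x t hx1 ht.1 ht.2
  rw [pow_succ', mul_assoc, norm_mul, Complex.norm_real, Real.norm_of_nonneg hx0.le] at this
  rw [dist_zero_left]
  rw [div_lt_iff₀ hε] at hx2
  exact lt_of_mul_lt_mul_left (this.trans_lt hx2) hx0.le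

end DecaysUpTo

end

section

/-! ### Symbols on a union of rays -/

/-- The union of the closed rays from `0` in the directions `D`. -/
def cone (D : Set ℂ) : Set ℂ := {z | ∃ d ∈ D, ∃ r : ℝ, 0 ≤ r ∧ z = r * d}

lemma mem_cone {D : Set ℂ} {d : ℂ} (hd : d ∈ D) {r : ℝ} (hr : 0 ≤ r) : (r : ℂ) * d ∈ cone D :=
  ⟨d, hd, r, hr, rfl⟩

variable {ι κ : Type*} [TopologicalSpace ι] [TopologicalSpace κ]

/-- `F` is continuous on `S ×ˢ P` and `O((1 + |z|) ^ p)` there. -/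
def PolyBounded (S : Set ℂ) (P : Set ι) (p : ℤ) (F : ℂ → ι → ℂ) : Prop :=
  ContinuousOn (fun q : ℂ × ι => F q.1 q.2) (S ×ˢ P) ∧
    ∃ C : ℝ, 0 ≤ C ∧ ∀ z ∈ S, ∀ q ∈ P, ‖F z q‖ ≤ C * (1 + ‖z‖) ^ p

/-- `F` has `n` derivatives along the rays `D`; its `j`-th derivative is `O((1 + |z|) ^ (p + 2 j))`,
uniformly in the parameter, and has the same value at `0` on all rays. -/
def IsSymbol (D : Set ℂ) (P : Set ι) : ℕ → ℤ → (ℂ → ι → ℂ) → Prop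
  | 0, p, F => PolyBounded (cone D) P p F
  | n + 1, p, F => PolyBounded (cone D) P p F ∧ ∃ F' : ℂ → ι → ℂ,
      (∀ d ∈ D, ∀ r : ℝ, 0 < r → ∀ q ∈ P,
        HasDerivAt (fun s : ℝ => F (s * d) q) (d * F' (r * d) q) r) ∧
      IsSymbol D P n (p + 2) F'

section

variable {S : Set ℂ} {D : Set ℂ} {P : Set ι} {p q : ℤ} {n : ℕ} {F G : ℂ → ι → ℂ}

lemma PolyBounded.mono (h : PolyBounded S P p F) (hpq : p ≤ q) : PolyBounded S P q F := by
  obtain ⟨hc, C, hC, hb⟩ := h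
  refine ⟨hc, C, hC, fun z hz x hx => (hb z hz x hx).trans ?_⟩
  have : (1 : ℝ) ≤ 1 + ‖z‖ := by linarith [norm_nonneg z]
  gcongr

lemma PolyBounded.add (hF : PolyBounded S P p F) (hG : PolyBounded S P p G) :
    PolyBounded S P p (fun z x => F z x + G z x) := by
  obtain ⟨hc, C, hC, hb⟩ := hF
  obtain ⟨hc', C', hC', hb'⟩ := hG
  refine ⟨hc.add hc', C + C', by positivity, fun z hz x hx => ?_⟩
  rw [add_mul]
  exact norm_add_le_of_le (hb z hz x hx) (hb' z hz x hx)

lemma PolyBounded.mul (hF : PolyBounded S P p F) (hG : PolyBounded S P q G) :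
    PolyBounded S P (p + q) (fun z x => F z x * G z x) := by
  obtain ⟨hc, C, hC, hb⟩ := hF
  obtain ⟨hc', C', hC', hb'⟩ := hG
  refine ⟨hc.mul hc', C * C', by positivity, fun z hz x hx => ?_⟩
  have : (0 : ℝ) < 1 + ‖z‖ := by linarith [norm_nonneg z]
  rw [zpow_add₀ this.ne', norm_mul, mul_mul_mul_comm]
  exact mul_le_mul (hb z hz x hx) (hb' z hz x hx) (norm_nonneg _) (by positivity)

namespace IsSymbol

lemma polyBounded (h : IsSymbol D P n p F) : PolyBounded (cone D) P p F := by
  cases n with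
  | zero => exact h
  | succ n => exact h.1

lemma continuousOn (h : IsSymbol D P n p F) :
    ContinuousOn (fun q : ℂ × ι => F q.1 q.2) (cone D ×ˢ P) := h.polyBounded.1

lemma mono (h : IsSymbol D P n p F) (hpq : p ≤ q) : IsSymbol D P n q F := by
  induction n generalizing p q F with
  | zero => exact PolyBounded.mono h hpq
  | succ n ih =>
    obtain ⟨h0, F', hd, h'⟩ := h
    exact ⟨h0.mono hpq, F', hd, ih h' (by lia)⟩

lemma of_succ (h : IsSymbol D P (n + 1) p F) : IsSymbol D P n p F := by
  induction n generalizing p F with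
  | zero => exact h.1
  | succ n ih =>
    obtain ⟨h0, F', hd, h'⟩ := h
    exact ⟨h0, F', hd, ih h'⟩

lemma congr (h : IsSymbol D P n p F) (hFG : ∀ z ∈ cone D, ∀ x ∈ P, F z x = G z x) :
    IsSymbol D P n p G := by
  have h0 : PolyBounded (cone D) P p G := by
    obtain ⟨hc, C, hC, hb⟩ := h.polyBounded
    refine ⟨hc.congr fun y hy => (hFG y.1 hy.1 y.2 hy.2).symm, C, hC, fun z hz x hx => ?_⟩
    rw [← hFG z hz x hx]
    exact hb z hz x hx
  cases n with
  | zero => exact h0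
  | succ n =>
    obtain ⟨_, F', hd, h'⟩ := h
    refine ⟨h0, F', fun d hdD r hr x hx => (hd d hdD r hr x hx).congr_of_eventuallyEq ?_, h'⟩
    filter_upwards [lt_mem_nhds hr] with s hs
    exact (hFG _ (mem_cone hdD (le_of_lt hs)) x hx).symm

lemma add (hF : IsSymbol D P n p F) (hG : IsSymbol D P n p G) :
    IsSymbol D P n p (fun z x => F z x + G z x) := by
  induction n generalizing p F G with
  | zero => exact PolyBounded.add hF hG
  | succ n ih =>
    obtain ⟨h0, F', hd, h'⟩ := hF
    obtain ⟨g0, G', gd, g'⟩ := hG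
    refine ⟨h0.add g0, fun z x => F' z x + G' z x, fun d hdD r hr x hx => ?_, ih h' g'⟩
    rw [mul_add]
    exact (hd d hdD r hr x hx).add (gd d hdD r hr x hx)

lemma mul (hF : IsSymbol D P n p F) (hG : IsSymbol D P n q G) :
    IsSymbol D P n (p + q) (fun z x => F z x * G z x) := by
  induction n generalizing p q F G with
  | zero => exact PolyBounded.mul hF hG
  | succ n ih =>
    have hF0 := hF.of_succ
    have hG0 := hG.of_succ
    obtain ⟨h0, F', hd, h'⟩ := hF
    obtain ⟨g0, G', gd, g'⟩ := hG
    refine ⟨h0.mul g0, fun z x => F' z x * G z x + F z x * G' z x,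
      fun d hdD r hr x hx => ?_, ((ih h' hG0).mono (by lia)).add ((ih hF0 g').mono (by lia))⟩
    refine ((hd d hdD r hr x hx).mul (gd d hdD r hr x hx)).congr_deriv ?_
    ring

lemma param {c : ι → ℂ} (hc : ContinuousOn c P) (hb : ∃ C, ∀ x ∈ P, ‖c x‖ ≤ C) :
    IsSymbol D P n 0 (fun _ x => c x) := by
  induction n generalizing c with
  | zero =>
    obtain ⟨C, hC⟩ := hb
    refine ⟨hc.comp continuousOn_snd fun y hy => hy.2, |C|, abs_nonneg _, fun z _ x hx => ?_⟩
    simpa using (hC x hx).trans (le_abs_self C)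
  | succ n ih =>
    refine ⟨(ih hc hb).polyBounded, fun _ _ => 0, fun d _ r _ x _ => ?_, ?_⟩
    · simpa using hasDerivAt_const r (c x)
    · exact (ih (c := fun _ => 0) continuousOn_const ⟨0, by simp⟩).mono (by lia)

lemma const (c : ℂ) : IsSymbol D P n 0 (fun _ _ => c) :=
  param (c := fun _ => c) continuousOn_const ⟨‖c‖, fun _ _ => le_rfl⟩

lemma const_mul (c : ℂ) (hF : IsSymbol D P n p F) : IsSymbol D P n p (fun z x => c * F z x) := by
  simpa using (const (D := D) (P := P) (n := n) c).mul hF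

lemma id : IsSymbol D P n 1 (fun z _ => z) := by
  have h0 : PolyBounded (cone D) P 1 (fun z _ => z) :=
    ⟨continuousOn_fst, 1, zero_le_one, fun z _ _ _ => by simp⟩
  cases n with
  | zero => exact h0
  | succ n =>
    refine ⟨h0, fun _ _ => 1, fun d _ r _ x _ => ?_, (const 1).mono (by lia)⟩
    simpa using (Complex.ofRealCLM.hasDerivAt (x := r)).mul_const d

lemma pow (hF : IsSymbol D P n p F) (k : ℕ) :
    IsSymbol D P n (k * p) (fun z x => F z x ^ k) := by
  induction k with
  | zero => simpa using const (D := D) (P := P) (n := n) 1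
  | succ k ih =>
    simp only [pow_succ]
    exact (ih.mul hF).mono (by push_cast; linarith)

lemma disp : IsSymbol D P n 3 (fun z _ => LinearKdV.disp z) :=
  (((id (D := D) (P := P) (n := n)).pow 3).const_mul (-Complex.I)).mono (by norm_num)

lemma comp {P' : Set κ} {h : κ → ι} (hF : IsSymbol D P n p F) (hc : ContinuousOn h P')
    (hm : MapsTo h P' P) : IsSymbol D P' n p (fun z x => F z (h x)) := by
  have base : ∀ {p : ℤ} {F : ℂ → ι → ℂ}, PolyBounded (cone D) P p F →
      PolyBounded (cone D) P' p (fun z x => F z (h x)) := by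
    rintro p F ⟨hcF, C, hC, hb⟩
    refine ⟨?_, C, hC, fun z hz x hx => hb z hz _ (hm hx)⟩
    exact hcF.comp (continuousOn_fst.prodMk (hc.comp continuousOn_snd fun y hy => hy.2))
      fun y hy => ⟨hy.1, hm hy.2⟩
  induction n generalizing p F with
  | zero => exact base hF
  | succ n ih =>
    obtain ⟨h0, F', hd, h'⟩ := hF
    exact ⟨base h0, fun z x => F' z (h x), fun d hdD r hr x hx => hd d hdD r hr _ (hm hx), ih h'⟩

end IsSymbol

lemma hasDerivAt_disp (z : ℂ) : HasDerivAt LinearKdV.disp (-3 * Complex.I * z ^ 2) z := by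
  refine ((hasDerivAt_pow 3 z).const_mul (-Complex.I)).congr_deriv ?_
  push_cast
  ring

lemma hasDerivAt_ray (d : ℂ) (r : ℝ) : HasDerivAt (fun s : ℝ => (s : ℂ) * d) d r := by
  simpa using (Complex.ofRealCLM.hasDerivAt (x := r)).mul_const d

namespace IsSymbol

/-- The oscillating factor `e^{-ω(z) s}`, on rays where `ω` is purely imaginary. -/
lemma exp_disp (hD : ∀ z ∈ cone D, (LinearKdV.disp z).re = 0) {s : ι → ℝ}
    (hs : ContinuousOn s P) (hb : ∃ C, ∀ x ∈ P, |s x| ≤ C) :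
    IsSymbol D P n 0 (fun z x => Complex.exp (-LinearKdV.disp z * s x)) := by
  have h0 : PolyBounded (cone D) P 0 (fun z x => Complex.exp (-LinearKdV.disp z * s x)) := by
    refine ⟨?_, 1, zero_le_one, fun z hz x _ => ?_⟩
    · have h1 : ContinuousOn (fun q : ℂ × ι => (s q.2 : ℂ)) (cone D ×ˢ P) :=
        Complex.continuous_ofReal.comp_continuousOn (hs.comp continuousOn_snd fun y hy => hy.2)
      have h2 : Continuous (fun q : ℂ × ι => -LinearKdV.disp q.1) := by
        unfold LinearKdV.disp; fun_prop
      exact (h2.continuousOn.mul h1).cexp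
    · simp [Complex.norm_exp, hD z hz]
  induction n with
  | zero => exact h0
  | succ n ih =>
    -- The factor `z ^ 2` coming from `ω'` is the reason why `IsSymbol` allows a loss of two orders
    -- per derivative.
    refine ⟨h0, fun z x => (3 * Complex.I * s x) * (z ^ 2 *
      Complex.exp (-LinearKdV.disp z * s x)), fun d _ r _ x _ => ?_, ?_⟩
    · have h1 := (hasDerivAt_disp (r * d)).comp_of_eq r (hasDerivAt_ray d r) rfl
      refine ((h1.neg.mul_const (s x : ℂ)).cexp).congr_deriv ?_
      simp only [Pi.neg_apply, Function.comp]
      ring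
    · have h1 : IsSymbol D P n 0 (fun _ x => 3 * Complex.I * (s x : ℂ)) := by
        refine param (continuousOn_const.mul (Complex.continuous_ofReal.comp_continuousOn hs)) ?_
        obtain ⟨C, hC⟩ := hb
        exact ⟨3 * C, fun x hx => by simpa using hC x hx⟩
      exact (h1.mul ((id.pow 2).mul ih)).mono (by norm_num)

/-- The factor `(1 + i z)⁻¹`, on rays where it does not blow up. -/
lemma inv_one_add {c : ℝ} (hc : 0 < c) (hD : ∀ z ∈ cone D, c * (1 + ‖z‖) ≤ ‖1 + Complex.I * z‖) :
    IsSymbol D P n (-1) (fun z _ => (1 + Complex.I * z)⁻¹) := by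
  have hpos : ∀ z ∈ cone D, 0 < ‖1 + Complex.I * z‖ := fun z hz =>
    lt_of_lt_of_le (by positivity) (hD z hz)
  have h0 : PolyBounded (cone D) P (-1) (fun z _ => (1 + Complex.I * z)⁻¹) := by
    refine ⟨?_, c⁻¹, by positivity, fun z hz x _ => ?_⟩
    · refine ContinuousOn.inv₀ (by fun_prop) fun y hy => ?_
      exact norm_pos_iff.1 (hpos _ hy.1)
    · rw [norm_inv, zpow_neg_one, ← mul_inv]
      exact inv_anti₀ (by positivity) (hD z hz)
  induction n with
  | zero => exact h0
  | succ n ih =>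
    refine ⟨h0, fun z _ => -Complex.I * ((1 + Complex.I * z)⁻¹) ^ 2, fun d hd r hr x _ => ?_, ?_⟩
    · have hne := norm_pos_iff.1 (hpos _ (mem_cone hd hr.le))
      refine ((((hasDerivAt_ray d r).const_mul Complex.I).const_add 1).inv hne).congr_deriv ?_
      field_simp
    · exact ((ih.pow 2).const_mul _).mono (by norm_num)

end IsSymbol

/-! ### Integrals of symbols over a parameter -/

/-- Turns the polynomial weight into a local constant, which serves as dominating function over the
compact parameter interval. -/
lemma exists_zpow_bound_near (p : ℤ) (z₀ : ℂ) :
    ∃ B : ℝ, 0 ≤ B ∧ ∀ᶠ z in 𝓝 z₀, (1 + ‖z‖) ^ p ≤ B := by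
  have hpos : ∀ z : ℂ, (0 : ℝ) < 1 + ‖z‖ := fun z => by linarith [norm_nonneg z]
  refine ⟨(1 + ‖z₀‖) ^ p + 1, by have := hpos z₀; positivity, ?_⟩
  have : ContinuousAt (fun z : ℂ => (1 + ‖z‖) ^ p) z₀ :=
    ContinuousAt.zpow₀ (by fun_prop) _ (Or.inl (hpos z₀).ne')
  exact (this.eventually_lt_const (lt_add_one _)).mono fun _ h => h.le

lemma PolyBounded.integral_param [FirstCountableTopology ι] {K : ℂ → ι × ℝ → ℂ}
    (hK : PolyBounded S (P ×ˢ Icc (0 : ℝ) 1) p K) :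
    PolyBounded S P p (fun z x => ∫ σ in Icc (0 : ℝ) 1, K z (x, σ)) := by
  obtain ⟨hc, C, hC, hb⟩ := hK
  refine ⟨?_, C, hC, fun z hz x hx => ?_⟩
  · rintro ⟨z₀, x₀⟩ ⟨hz₀, hx₀⟩
    obtain ⟨B, hB, hev⟩ := exists_zpow_bound_near p z₀
    have hmem : ∀ᶠ y : ℂ × ι in 𝓝[S ×ˢ P] (z₀, x₀), y ∈ S ×ˢ P := self_mem_nhdsWithin
    refine continuousWithinAt_of_dominated (bound := fun _ => C * B) ?_ ?_
      (integrable_const _) ?_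
    · filter_upwards [hmem] with y hy
      refine ContinuousOn.aestronglyMeasurable ?_ measurableSet_Icc
      exact hc.comp (f := fun σ : ℝ => (y.1, y.2, σ)) (s := Icc 0 1) (by fun_prop)
        fun σ hσ => ⟨hy.1, hy.2, hσ⟩
    · have hev' : ∀ᶠ y : ℂ × ι in 𝓝[S ×ˢ P] (z₀, x₀), (1 + ‖y.1‖) ^ p ≤ B :=
        nhdsWithin_le_nhds ((continuousAt_fst (p := (z₀, x₀))).eventually hev)
      filter_upwards [hmem, hev'] with y hy hyB
      filter_upwards [ae_restrict_mem measurableSet_Icc] with σ hσ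
      exact (hb _ hy.1 _ ⟨hy.2, hσ⟩).trans (mul_le_mul_of_nonneg_left hyB hC)
    · filter_upwards [ae_restrict_mem measurableSet_Icc] with σ hσ
      have : ContinuousOn (fun y : ℂ × ι => K y.1 (y.2, σ)) (S ×ˢ P) :=
        hc.comp (f := fun y : ℂ × ι => (y.1, y.2, σ)) (s := S ×ˢ P) (by fun_prop)
          fun y hy => ⟨hy.1, hy.2, hσ⟩
      exact this _ ⟨hz₀, hx₀⟩
  · have := norm_setIntegral_le_of_norm_le_const (μ := volume) (s := Icc (0 : ℝ) 1)
      (f := fun σ => K z (x, σ)) (C := C * (1 + ‖z‖) ^ p) (by simp)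
      (fun σ hσ => hb z hz (x, σ) ⟨hx, hσ⟩)
    simpa using this

lemma IsSymbol.integral_param [FirstCountableTopology ι] {K : ℂ → ι × ℝ → ℂ}
    (hK : IsSymbol D (P ×ˢ Icc (0 : ℝ) 1) n p K) :
    IsSymbol D P n p (fun z x => ∫ σ in Icc (0 : ℝ) 1, K z (x, σ)) := by
  induction n generalizing p K with
  | zero => exact PolyBounded.integral_param hK
  | succ n ih =>
    obtain ⟨h0, K', hd, h'⟩ := hK
    refine ⟨h0.integral_param, _, fun d hdD r hr x hx => ?_, ih h'⟩
    have h'0 := h'.polyBounded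
    obtain ⟨hc, -⟩ := h0
    obtain ⟨hc', C, hC, hb⟩ := h'0
    obtain ⟨B, hB, hev⟩ := exists_zpow_bound_near (p + 2) (r * d)
    have hev' : ∀ᶠ s : ℝ in 𝓝 r, (1 + ‖(s : ℂ) * d‖) ^ (p + 2) ≤ B :=
      (hasDerivAt_ray d r).continuousAt.eventually hev
    have meas : ∀ {L : ℂ → ι × ℝ → ℂ}, ContinuousOn (fun q : ℂ × ι × ℝ => L q.1 q.2)
        (cone D ×ˢ P ×ˢ Icc (0 : ℝ) 1) → ∀ s : ℝ, 0 < s →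
        AEStronglyMeasurable (fun σ => L (s * d) (x, σ)) (volume.restrict (Icc 0 1)) := by
      intro L hL s hs
      refine ContinuousOn.aestronglyMeasurable ?_ measurableSet_Icc
      exact hL.comp (f := fun σ : ℝ => ((s : ℂ) * d, x, σ)) (s := Icc 0 1) (by fun_prop)
        fun σ hσ => ⟨mem_cone hdD hs.le, hx, hσ⟩
    have key := hasDerivAt_integral_of_dominated_loc_of_deriv_le
      (μ := volume.restrict (Icc (0 : ℝ) 1)) (𝕜 := ℝ) (x₀ := r)
      (F := fun s σ => K (s * d) (x, σ)) (F' := fun s σ => d * K' (s * d) (x, σ))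
      (bound := fun _ => ‖d‖ * (C * B)) (s := {s | 0 < s ∧ (1 + ‖(s : ℂ) * d‖) ^ (p + 2) ≤ B})
      ((lt_mem_nhds hr).and hev') ?_ ?_ ?_ ?_ (integrable_const _) ?_
    · have h2 := key.2
      rwa [integral_const_mul] at h2
    · filter_upwards [lt_mem_nhds hr] with s hs using meas hc s hs
    · have : ContinuousOn (fun σ => K (r * d) (x, σ)) (Icc (0 : ℝ) 1) :=
        hc.comp (f := fun σ : ℝ => ((r : ℂ) * d, x, σ)) (s := Icc 0 1) (by fun_prop)
          fun σ hσ => ⟨mem_cone hdD hr.le, hx, hσ⟩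
      exact this.integrableOn_Icc
    · exact (meas hc' r hr).const_mul d
    · filter_upwards [ae_restrict_mem measurableSet_Icc] with σ hσ s hs
      rw [norm_mul]
      refine mul_le_mul_of_nonneg_left ?_ (norm_nonneg _)
      exact (hb _ (mem_cone hdD hs.1.le) _ ⟨hx, hσ⟩).trans (mul_le_mul_of_nonneg_left hs.2 hC)
    · filter_upwards [ae_restrict_mem measurableSet_Icc] with σ hσ s hs
      exact hd d hdD s hs.1 _ ⟨hx, hσ⟩

end

end

section

/-! ### Half-line Fourier transforms of rapidly decreasing functions -/

lemma norm_exp_neg_I_mul_le {w : ℂ} (hw : w.im ≤ 0) {y : ℝ} (hy : 0 ≤ y) :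
    ‖Complex.exp (-Complex.I * w * y)‖ ≤ 1 := by
  rw [Complex.norm_exp, Real.exp_le_one_iff]
  simp only [neg_mul, Complex.neg_re, Complex.mul_re, Complex.I_re, zero_mul, Complex.I_im,
    one_mul, zero_sub, Complex.ofReal_re, Complex.mul_im, Complex.ofReal_im, mul_zero, sub_zero,
    neg_neg]
  exact mul_nonpos_of_nonpos_of_nonneg hw hy

lemma norm_exp_neg_I_mul_mul_le {w : ℂ} (hw : w.im ≤ 0) {y : ℝ} (hy : 0 ≤ y) {c : ℂ} {B : ℝ}
    (hc : ‖c‖ ≤ B) : ‖Complex.exp (-Complex.I * w * y) * c‖ ≤ B := by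
  rw [norm_mul]
  calc _ ≤ 1 * ‖c‖ := mul_le_mul_of_nonneg_right (norm_exp_neg_I_mul_le hw hy) (norm_nonneg _)
    _ ≤ _ := by rwa [one_mul]

variable {ι : Type*} [TopologicalSpace ι]

/-- `h(y, q)` is continuous for `y ≥ 0`, `q ∈ P` and decays faster than any power of `y`, uniformly
in `q ∈ P`. -/
structure RapidOn (P : Set ι) (h : ℝ → ι → ℂ) : Prop where
  cont : ContinuousOn (fun p : ℝ × ι => h p.1 p.2) (Ici 0 ×ˢ P)
  decay : ∀ l : ℕ, ∃ C : ℝ, ∀ y : ℝ, 0 ≤ y → ∀ q ∈ P, ‖(y : ℂ) ^ l * h y q‖ ≤ C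

section

variable {P : Set ι} {h h₁ : ℝ → ι → ℂ}

lemma RapidOn.add (hh : RapidOn P h) (hh₁ : RapidOn P h₁) :
    RapidOn P (fun y q => h y q + h₁ y q) := by
  refine ⟨hh.cont.add hh₁.cont, fun l => ?_⟩
  obtain ⟨C, hC⟩ := hh.decay l
  obtain ⟨C', hC'⟩ := hh₁.decay l
  refine ⟨C + C', fun y hy q hq => ?_⟩
  rw [mul_add]
  exact norm_add_le_of_le (hC y hy q hq) (hC' y hy q hq)

lemma RapidOn.mul_neg_I (hh : RapidOn P h) : RapidOn P (fun y q => -Complex.I * y * h y q) := by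
  refine ⟨?_, fun l => ?_⟩
  · have : Continuous (fun p : ℝ × ι => -Complex.I * (p.1 : ℂ)) := by fun_prop
    exact this.continuousOn.mul hh.cont
  · obtain ⟨C, hC⟩ := hh.decay (l + 1)
    refine ⟨C, fun y hy q hq => le_trans (le_of_eq ?_) (hC y hy q hq)⟩
    simp only [norm_mul, norm_neg, Complex.norm_I, norm_pow, pow_succ]
    ring

/-- The decay estimates for `l = 0` and `l = 2` add up to an integrable majorant independent of the
parameter. -/
lemma RapidOn.bound (hh : RapidOn P h) :
    ∃ C : ℝ, ∀ y : ℝ, 0 ≤ y → ∀ q ∈ P, ‖h y q‖ ≤ C * (1 + y ^ 2)⁻¹ := by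
  obtain ⟨C, hC⟩ := hh.decay 0
  obtain ⟨C', hC'⟩ := hh.decay 2
  refine ⟨C + C', fun y hy q hq => ?_⟩
  have h1 := hC y hy q hq
  have h2 := hC' y hy q hq
  simp only [pow_zero, one_mul, norm_mul, norm_pow, Complex.norm_real, Real.norm_eq_abs,
    sq_abs] at h1 h2
  rw [← div_eq_mul_inv, le_div_iff₀ (by positivity)]
  linarith

lemma RapidOn.continuousOn_slice (hh : RapidOn P h) {q : ι} (hq : q ∈ P) :
    ContinuousOn (fun y => h y q) (Ici 0) :=
  hh.cont.comp (f := fun y : ℝ => (y, q)) (s := Ici 0) (by fun_prop) fun _ hy => ⟨hy, hq⟩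

lemma RapidOn.aestronglyMeasurable_hat (hh : RapidOn P h) (w : ℂ) {q : ι} (hq : q ∈ P) :
    AEStronglyMeasurable (fun y : ℝ => Complex.exp (-Complex.I * w * y) * h y q)
      (volume.restrict (Ioi 0)) := by
  refine ContinuousOn.aestronglyMeasurable ?_ measurableSet_Ioi
  exact (by fun_prop : Continuous fun y : ℝ => Complex.exp (-Complex.I * w * y)).continuousOn.mul
    ((hh.continuousOn_slice hq).mono Ioi_subset_Ici_self)

lemma integrable_const_mul_inv_one_add_sq (C : ℝ) (s : Set ℝ) :
    IntegrableOn (fun y : ℝ => C * (1 + y ^ 2)⁻¹) s :=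
  (integrable_inv_one_add_sq.const_mul C).integrableOn

lemma RapidOn.integrable_hat (hh : RapidOn P h) {w : ℂ} (hw : w.im ≤ 0) {q : ι} (hq : q ∈ P) :
    IntegrableOn (fun y : ℝ => Complex.exp (-Complex.I * w * y) * h y q) (Ioi 0) := by
  obtain ⟨C, hC⟩ := hh.bound
  refine Integrable.mono' (integrable_const_mul_inv_one_add_sq C _)
    (hh.aestronglyMeasurable_hat w hq) ?_
  filter_upwards [ae_restrict_mem measurableSet_Ioi] with y hy
  exact norm_exp_neg_I_mul_mul_le hw (le_of_lt hy) (hC _ (le_of_lt hy) _ hq)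

lemma RapidOn.polyBounded_hat [FirstCountableTopology ι] {S : Set ℂ} (hh : RapidOn P h) {β : ℂ}
    (hS : ∀ z ∈ S, (β * z).im ≤ 0) :
    PolyBounded S P 0 (fun z q => hat (fun y => h y q) (β * z)) := by
  obtain ⟨C, hC⟩ := hh.bound
  have hbd : ∀ y ∈ S ×ˢ P, ∀ᵐ a : ℝ ∂(volume.restrict (Ioi (0 : ℝ))),
      ‖Complex.exp (-Complex.I * (β * y.1) * a) * h a y.2‖ ≤ C * (1 + a ^ 2)⁻¹ := by
    intro y hy
    filter_upwards [ae_restrict_mem measurableSet_Ioi] with a ha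
    exact norm_exp_neg_I_mul_mul_le (hS _ hy.1) (le_of_lt ha) (hC _ (le_of_lt ha) _ hy.2)
  refine ⟨?_, |∫ y in Ioi (0 : ℝ), C * (1 + y ^ 2)⁻¹|, abs_nonneg _, fun z hz q hq => ?_⟩
  · refine continuousOn_of_dominated (bound := fun y : ℝ => C * (1 + y ^ 2)⁻¹)
      (fun y hy => hh.aestronglyMeasurable_hat _ hy.2) hbd
      (integrable_const_mul_inv_one_add_sq C _) ?_
    filter_upwards [ae_restrict_mem measurableSet_Ioi] with a ha
    refine ContinuousOn.mul ?_ ?_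
    · exact Continuous.continuousOn (by fun_prop)
    · exact hh.cont.comp (f := fun y : ℂ × ι => (a, y.2)) (s := S ×ˢ P) (by fun_prop)
        fun y hy => ⟨mem_Ici.2 (le_of_lt ha), hy.2⟩
  · rw [zpow_zero, mul_one]
    exact (norm_integral_le_of_norm_le (integrable_const_mul_inv_one_add_sq C _)
      (hbd (z, q) ⟨hz, hq⟩)).trans (le_abs_self _)

/-- Differentiation in `z` multiplies the data by `-iy`, which preserves rapid decrease. All
derivatives are therefore bounded, and the permitted loss of two orders is slack here. -/
lemma RapidOn.isSymbol_hat [FirstCountableTopology ι] {D : Set ℂ} (hh : RapidOn P h) {β : ℂ}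
    (hD : ∀ z ∈ cone D, (β * z).im ≤ 0) (n : ℕ) :
    IsSymbol D P n 0 (fun z q => hat (fun y => h y q) (β * z)) := by
  induction n generalizing h with
  | zero => exact hh.polyBounded_hat hD
  | succ n ih =>
    have hh' := hh.mul_neg_I
    refine ⟨hh.polyBounded_hat hD, _, fun d hd r hr q hq => ?_,
      ((ih hh').const_mul β).mono (by norm_num)⟩
    obtain ⟨C, hC⟩ := hh'.bound
    have key := hasDerivAt_integral_of_dominated_loc_of_deriv_le
      (μ := volume.restrict (Ioi (0 : ℝ))) (𝕜 := ℝ) (x₀ := r)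
      (F := fun s y => Complex.exp (-Complex.I * (β * (s * d)) * y) * h y q)
      (F' := fun s y => d * β * (Complex.exp (-Complex.I * (β * (s * d)) * y) *
        (-Complex.I * y * h y q)))
      (bound := fun y => ‖d * β‖ * (C * (1 + y ^ 2)⁻¹)) (s := Ioi 0)
      (Ioi_mem_nhds hr) ?_ (hh.integrable_hat (hD _ (mem_cone hd hr.le)) hq) ?_ ?_
      ((integrable_const_mul_inv_one_add_sq C _).const_mul _) ?_
    · have h2 := key.2
      rw [integral_const_mul, mul_assoc] at h2
      exact h2
    · exact Eventually.of_forall fun s => hh.aestronglyMeasurable_hat _ hq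
    · exact (hh'.aestronglyMeasurable_hat _ hq).const_mul _
    · filter_upwards [ae_restrict_mem measurableSet_Ioi] with y hy s hs
      rw [norm_mul]
      exact mul_le_mul_of_nonneg_left (norm_exp_neg_I_mul_mul_le
        (hD _ (mem_cone hd (le_of_lt hs))) (le_of_lt hy) (hC _ (le_of_lt hy) _ hq)) (norm_nonneg _)
    · refine Eventually.of_forall fun y s _ => ?_
      refine (((((hasDerivAt_ray d s).const_mul β).const_mul (-Complex.I)).mul_const
        (y : ℂ)).cexp.mul_const (h y q)).congr_deriv ?_
      ring

/-- Integration by parts for the half-line Fourier transform. -/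
lemma RapidOn.hat_eq (hh : RapidOn P h) (hh₁ : RapidOn P h₁) {q : ι} (hq : q ∈ P)
    (hd : ∀ y : ℝ, 0 < y → HasDerivAt (fun y => h y q) (h₁ y q) y) {w : ℂ} (hw : w.im ≤ 0) :
    (1 + Complex.I * w) * hat (fun y => h y q) w =
      h 0 q + hat (fun y => h y q + h₁ y q) w := by
  have i0 := hh.integrable_hat hw hq
  have i1 := hh₁.integrable_hat hw hq
  have hder : ∀ y ∈ Ioi (0 : ℝ), HasDerivAt
      (fun y : ℝ => Complex.exp (-Complex.I * w * y) * h y q)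
      (Complex.exp (-Complex.I * w * y) * h₁ y q -
        Complex.I * w * (Complex.exp (-Complex.I * w * y) * h y q)) y := by
    intro y hy
    refine (((Complex.ofRealCLM.hasDerivAt (x := y)).const_mul (-Complex.I * w)).cexp.mul
      (hd y hy)).congr_deriv ?_
    simp only [Complex.ofRealCLM_apply, Complex.ofReal_one]
    ring
  have i2 := i1.sub (i0.const_mul (Complex.I * w))
  have hcont : ContinuousOn (fun y : ℝ => Complex.exp (-Complex.I * w * y) * h y q) (Ici 0) :=
    (by fun_prop : Continuous fun y : ℝ => Complex.exp (-Complex.I * w * y)).continuousOn.mul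
      (hh.continuousOn_slice hq)
  -- The boundary term at infinity vanishes because the function and its derivative are both
  -- integrable.
  have key := integral_Ioi_of_hasDerivAt_of_tendsto (hcont 0 self_mem_Ici) hder i2
    (tendsto_zero_of_hasDerivAt_of_integrableOn_Ioi hder i2 i0)
  rw [integral_sub i1 (i0.const_mul _), integral_const_mul] at key
  have hsum : hat (fun y => h y q + h₁ y q) w =
      hat (fun y => h y q) w + hat (fun y => h₁ y q) w := by
    unfold hat
    rw [← integral_add i0 i1]
    simp only [mul_add]
  rw [hsum]
  unfold hat at *
  simp only [Complex.ofReal_zero, mul_zero, Complex.exp_zero, one_mul, zero_sub] at key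
  linear_combination -key

end

/-- Differentiation of a half-line Fourier transform with respect to a parameter. -/
lemma hasDerivAt_hat_param {h h₁ : ℝ → ℝ → ℂ} (hh : ∀ T, RapidOn (Icc 0 T) h)
    (hh₁ : ∀ T, RapidOn (Icc 0 T) h₁) {w : ℂ} (hw : w.im ≤ 0)
    (hd : ∀ y τ : ℝ, 0 ≤ y → 0 < τ → HasDerivAt (fun s => h y s) (h₁ y τ) τ) {τ : ℝ}
    (hτ : 0 < τ) :
    HasDerivAt (fun s => hat (fun y => h y s) w) (hat (fun y => h₁ y τ) w) τ := by
  obtain ⟨C, hC⟩ := (hh₁ (τ + 1)).bound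
  have hmem : Ioo 0 (τ + 1) ∈ 𝓝 τ := isOpen_Ioo.mem_nhds ⟨hτ, lt_add_one τ⟩
  refine (hasDerivAt_integral_of_dominated_loc_of_deriv_le
    (μ := volume.restrict (Ioi (0 : ℝ))) (𝕜 := ℝ) (x₀ := τ)
    (F := fun s y => Complex.exp (-Complex.I * w * y) * h y s)
    (F' := fun s y => Complex.exp (-Complex.I * w * y) * h₁ y s)
    (bound := fun y => C * (1 + y ^ 2)⁻¹) (s := Ioo 0 (τ + 1)) hmem ?_
    ((hh τ).integrable_hat hw ⟨hτ.le, le_rfl⟩)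
    ((hh₁ τ).aestronglyMeasurable_hat _ ⟨hτ.le, le_rfl⟩) ?_
    (integrable_const_mul_inv_one_add_sq C _) ?_).2
  · filter_upwards [hmem] with s hs
    exact (hh (τ + 1)).aestronglyMeasurable_hat _ ⟨hs.1.le, hs.2.le⟩
  · filter_upwards [ae_restrict_mem measurableSet_Ioi] with y hy s hs
    exact norm_exp_neg_I_mul_mul_le hw (le_of_lt hy) (hC _ (le_of_lt hy) _ ⟨hs.1.le, hs.2.le⟩)
  · filter_upwards [ae_restrict_mem measurableSet_Ioi] with y hy s hs
    exact (hd y s (le_of_lt hy) hs.1).const_mul _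

end

section

/-! ### Time-dependent amplitudes and the evolution operator -/

/-- `F(z, t)` is smooth in `t > 0`, and its `m`-th `t`-derivative is a symbol of order `p + 3 m`,
uniformly for bounded `t ≥ 0`. -/
def IsAmplitude (D : Set ℂ) (n : ℕ) (p : ℤ) (F : ℂ → ℝ → ℂ) : Prop :=
  ∃ G : ℕ → ℂ → ℝ → ℂ,
    (∀ z ∈ cone D, ∀ t : ℝ, 0 ≤ t → G 0 z t = F z t) ∧
    (∀ m, ∀ z ∈ cone D, ∀ t : ℝ, 0 < t → HasDerivAt (G m z) (G (m + 1) z t) t) ∧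
    ∀ m T, IsSymbol D (Icc 0 T) n (p + 3 * (m : ℕ)) (G m)

/-- The solution `E` of `E_t + ω(z) E = μ A(z, t)`, `E(z, 0) = κ A(z, 0)`. -/
noncomputable def evolve (κ μ : ℂ) (A : ℂ → ℝ → ℂ) (z : ℂ) (t : ℝ) : ℂ :=
  κ * (Complex.exp (-disp z * t) * A z 0) +
    μ * ∫ τ in (0 : ℝ)..t, Complex.exp (-disp z * (t - τ : ℝ)) * A z τ

variable {D : Set ℂ} {n : ℕ} {p q : ℤ} {F G A B : ℂ → ℝ → ℂ} {κ μ : ℂ}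

namespace IsAmplitude

lemma congr (hF : IsAmplitude D n p F) (h : ∀ z ∈ cone D, ∀ t : ℝ, 0 ≤ t → F z t = G z t) :
    IsAmplitude D n p G := by
  obtain ⟨K, h0, h1, h2⟩ := hF
  exact ⟨K, fun z hz t ht => (h0 z hz t ht).trans (h z hz t ht), h1, h2⟩

lemma add (hF : IsAmplitude D n p F) (hG : IsAmplitude D n p G) :
    IsAmplitude D n p (fun z t => F z t + G z t) := by
  obtain ⟨K, h0, h1, h2⟩ := hF
  obtain ⟨L, g0, g1, g2⟩ := hG
  refine ⟨fun m z t => K m z t + L m z t, fun z hz t ht => ?_, fun m z hz t ht =>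
    (h1 m z hz t ht).add (g1 m z hz t ht), fun m T => (h2 m T).add (g2 m T)⟩
  simp only [h0 z hz t ht, g0 z hz t ht]

lemma symbol_mul {a : ℂ → ℂ} (ha : IsSymbol D (univ : Set ℝ) n q (fun z _ => a z))
    (hF : IsAmplitude D n p F) : IsAmplitude D n (q + p) (fun z t => a z * F z t) := by
  obtain ⟨K, h0, h1, h2⟩ := hF
  refine ⟨fun m z t => a z * K m z t, fun z hz t ht => ?_, fun m z hz t ht =>
    (h1 m z hz t ht).const_mul _, fun m T => ?_⟩
  · simp only [h0 z hz t ht]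
  · rw [add_assoc]
    exact (ha.comp continuousOn_id (mapsTo_univ _ _)).mul (h2 m T)

lemma const_mul (c : ℂ) (hF : IsAmplitude D n p F) : IsAmplitude D n p (fun z t => c * F z t) := by
  simpa using symbol_mul (IsSymbol.const c) hF

lemma param {c : ℕ → ℝ → ℂ} (hc : ∀ m, ContinuousOn (c m) (Ici 0))
    (hd : ∀ m t, 0 < t → HasDerivAt (c m) (c (m + 1) t) t) :
    IsAmplitude D n 0 (fun _ t => c 0 t) := by
  refine ⟨fun m _ t => c m t, fun _ _ _ _ => rfl, fun m _ _ t ht => hd m t ht, fun m T => ?_⟩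
  have hc' : ContinuousOn (c m) (Icc 0 T) := (hc m).mono Icc_subset_Ici_self
  exact (IsSymbol.param hc' (isCompact_Icc.exists_bound_of_continuousOn hc')).mono (by lia)

lemma hat {h : ℕ → ℝ → ℝ → ℂ} (hh : ∀ m T, RapidOn (Icc 0 T) (h m))
    (hd : ∀ m, ∀ y τ : ℝ, 0 ≤ y → 0 < τ → HasDerivAt (fun s => h m y s) (h (m + 1) y τ) τ)
    {β : ℂ} (hD : ∀ z ∈ cone D, (β * z).im ≤ 0) :
    IsAmplitude D n 0 (fun z τ => LinearKdV.hat (fun y => h 0 y τ) (β * z)) :=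
  ⟨fun m z τ => LinearKdV.hat (fun y => h m y τ) (β * z), fun _ _ _ _ => rfl, fun m z hz _ ht =>
    hasDerivAt_hat_param (hh m) (hh (m + 1)) (hD z hz) (hd m) ht,
    fun m T => ((hh m T).isSymbol_hat hD n).mono (by lia)⟩

lemma continuousOn (hF : IsAmplitude D n p F) (T : ℝ) :
    ContinuousOn (fun q : ℂ × ℝ => F q.1 q.2) (cone D ×ˢ Icc 0 T) := by
  obtain ⟨K, h0, h1, h2⟩ := hF
  exact (h2 0 T).continuousOn.congr fun q hq => (h0 _ hq.1 _ hq.2.1).symm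

lemma continuousOn_time (hF : IsAmplitude D n p F) {z : ℂ} (hz : z ∈ cone D) :
    ContinuousOn (F z) (Ici 0) := by
  intro t ht
  have h1 : ContinuousOn (F z) (Icc 0 (t + 1)) :=
    (hF.continuousOn (t + 1)).comp (f := fun t : ℝ => (z, t)) (by fun_prop) fun s hs => ⟨hz, hs⟩
  refine (h1 t ⟨ht, by linarith⟩).mono_of_mem_nhdsWithin ?_
  filter_upwards [self_mem_nhdsWithin, nhdsWithin_le_nhds (gt_mem_nhds (lt_add_one t))]
    with s hs hs' using ⟨hs, le_of_lt hs'⟩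

end IsAmplitude

/-! Properties of `evolve`. -/

/-- This factored form matches `gTilde` and `fTilde` and is convenient for algebra and for
differentiation in `t`. The defining form, in which only the lag `t - τ ≥ 0` appears, is the one
that yields estimates. -/
lemma evolve_eq (κ μ : ℂ) (A : ℂ → ℝ → ℂ) (z : ℂ) (t : ℝ) :
    evolve κ μ A z t = Complex.exp (-disp z * t) *
      (κ * A z 0 + μ * ∫ τ in (0 : ℝ)..t, Complex.exp (disp z * τ) * A z τ) := by
  have : ∀ τ : ℝ, Complex.exp (-disp z * (t - τ : ℝ)) * A z τ =
      Complex.exp (-disp z * t) * (Complex.exp (disp z * τ) * A z τ) := by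
    intro τ
    rw [← mul_assoc, ← Complex.exp_add]
    congr 2
    push_cast
    ring
  simp only [evolve, this, intervalIntegral.integral_const_mul]
  ring

lemma evolve_congr {z : ℂ} {t : ℝ} (ht : 0 ≤ t) (h : ∀ τ, 0 ≤ τ → τ ≤ t → A z τ = B z τ) :
    evolve κ μ A z t = evolve κ μ B z t := by
  have h1 : EqOn (fun τ : ℝ => Complex.exp (-disp z * (t - τ : ℝ)) * A z τ)
      (fun τ : ℝ => Complex.exp (-disp z * (t - τ : ℝ)) * B z τ) (uIcc 0 t) := by
    intro τ hτ
    rw [uIcc_of_le ht] at hτ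
    simp only [h τ hτ.1 hτ.2]
  rw [evolve, evolve, h 0 le_rfl ht, intervalIntegral.integral_congr h1]

lemma evolve_mul_left (a : ℂ → ℂ) (z : ℂ) (t : ℝ) :
    evolve κ μ (fun z τ => a z * A z τ) z t = a z * evolve κ μ A z t := by
  simp only [evolve_eq, mul_left_comm _ (a z), intervalIntegral.integral_const_mul]
  ring

lemma evolve_add {z : ℂ} {t : ℝ} (ht : 0 ≤ t) (hA : ContinuousOn (A z) (Ici 0))
    (hB : ContinuousOn (B z) (Ici 0)) :
    evolve κ μ (fun z τ => A z τ + B z τ) z t = evolve κ μ A z t + evolve κ μ B z t := by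
  have hi : ∀ {A : ℂ → ℝ → ℂ}, ContinuousOn (A z) (Ici 0) →
      IntervalIntegrable (fun τ : ℝ => Complex.exp (disp z * τ) * A z τ) volume 0 t := by
    intro A hA
    refine ContinuousOn.intervalIntegrable ?_
    rw [uIcc_of_le ht]
    exact (by fun_prop : Continuous fun τ : ℝ => Complex.exp (disp z * τ)).continuousOn.mul
      (hA.mono Icc_subset_Ici_self)
  simp only [evolve_eq, mul_add, intervalIntegral.integral_add (hi hA) (hi hB)]
  ring

lemma hasDerivAt_evolve {z : ℂ} (hA : ContinuousOn (A z) (Ici 0)) {t : ℝ} (ht : 0 < t) :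
    HasDerivAt (evolve κ μ A z) (μ * A z t - disp z * evolve κ μ A z t) t := by
  have hf : ContinuousOn (fun τ : ℝ => Complex.exp (disp z * τ) * A z τ) (Ici 0) :=
    (by fun_prop : Continuous fun τ : ℝ => Complex.exp (disp z * τ)).continuousOn.mul hA
  have h1 : HasDerivAt (fun t : ℝ => ∫ τ in (0 : ℝ)..t, Complex.exp (disp z * τ) * A z τ)
      (Complex.exp (disp z * t) * A z t) t := by
    refine intervalIntegral.integral_hasDerivAt_right ?_ ?_ (hf.continuousAt (Ici_mem_nhds ht))
    · refine ContinuousOn.intervalIntegrable ?_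
      rw [uIcc_of_le ht.le]
      exact hf.mono Icc_subset_Ici_self
    · exact (hf.mono Ioi_subset_Ici_self).stronglyMeasurableAtFilter isOpen_Ioi t ht
  have h2 : HasDerivAt (fun t : ℝ => Complex.exp (-disp z * t))
      (Complex.exp (-disp z * t) * (-disp z)) t := by
    simpa using ((Complex.ofRealCLM.hasDerivAt (x := t)).const_mul (-disp z)).cexp
  have h3 := h2.mul ((h1.const_mul μ).const_add (κ * A z 0))
  have e : evolve κ μ A z = fun t : ℝ => Complex.exp (-disp z * t) *
      (κ * A z 0 + μ * ∫ τ in (0 : ℝ)..t, Complex.exp (disp z * τ) * A z τ) :=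
    funext fun t => evolve_eq κ μ A z t
  rw [e]
  refine h3.congr_deriv ?_
  have h4 : Complex.exp (-disp z * t) * Complex.exp (disp z * t) = 1 := by
    rw [← Complex.exp_add]; simp
  linear_combination (μ * A z t) * h4

/-- The substitution `τ = t σ` moves the integral to the fixed interval `[0, 1]`. The integrand
becomes a product of symbols with parameter `(t, σ)`, and `IsSymbol.integral_param` applies. -/
lemma IsSymbol.evolve (hD : ∀ z ∈ cone D, (LinearKdV.disp z).re = 0) {T : ℝ}
    (hA : IsSymbol D (Icc 0 T) n p A) : IsSymbol D (Icc 0 T) n p (LinearKdV.evolve κ μ A) := by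
  have e : ∀ (z : ℂ) (t : ℝ), LinearKdV.evolve κ μ A z t =
      κ * (Complex.exp (-LinearKdV.disp z * t) * A z 0) + μ * ∫ σ in Icc (0 : ℝ) 1,
        (t : ℂ) * (Complex.exp (-LinearKdV.disp z * (t * (1 - σ) : ℝ)) * A z (t * σ)) := by
    intro z t
    have h := intervalIntegral.smul_integral_comp_mul_left (a := 0) (b := 1)
      (fun τ : ℝ => Complex.exp (-LinearKdV.disp z * (t - τ : ℝ)) * A z τ) t
    rw [mul_zero, mul_one] at h
    rw [LinearKdV.evolve, ← h, intervalIntegral.integral_of_le zero_le_one,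
      ← integral_Icc_eq_integral_Ioc, integral_const_mul, Complex.real_smul]
    congr 3
    refine integral_congr_ae (Eventually.of_forall fun σ => ?_)
    simp only [mul_sub, mul_one]
  have h1 : IsSymbol D (Icc 0 T) n p
      (fun z t => Complex.exp (-LinearKdV.disp z * t) * A z 0) := by
    have b : ∃ C, ∀ x ∈ Icc 0 T, |x| ≤ C := ⟨T, fun x hx => by rw [abs_of_nonneg hx.1]; exact hx.2⟩
    have := (IsSymbol.exp_disp (n := n) hD (P := Icc 0 T) (s := fun t => t) continuousOn_id b).mul
      (hA.comp (P' := Icc 0 T) (h := fun _ => 0) continuousOn_const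
        fun x hx => ⟨le_rfl, hx.1.trans hx.2⟩)
    simpa using this
  have b2 : ∀ x ∈ Icc 0 T ×ˢ Icc (0 : ℝ) 1, x.1 * x.2 ∈ Icc 0 T := by
    rintro ⟨t, σ⟩ ⟨ht, hσ⟩
    exact ⟨mul_nonneg ht.1 hσ.1, (mul_le_of_le_one_right ht.1 hσ.2).trans ht.2⟩
  have b3 : ∃ C, ∀ x ∈ Icc 0 T ×ˢ Icc (0 : ℝ) 1, |x.1 * (1 - x.2)| ≤ C := by
    refine ⟨T, fun x hx => ?_⟩
    have := b2 (x.1, 1 - x.2) ⟨hx.1, by linarith [hx.2.2], by linarith [hx.2.1]⟩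
    rw [abs_of_nonneg this.1]
    exact this.2
  have h2 : IsSymbol D (Icc 0 T ×ˢ Icc (0 : ℝ) 1) n p (fun z x => (x.1 : ℂ) *
      (Complex.exp (-LinearKdV.disp z * (x.1 * (1 - x.2) : ℝ)) * A z (x.1 * x.2))) := by
    have i1 : IsSymbol D (Icc 0 T ×ˢ Icc (0 : ℝ) 1) n 0 (fun _ x => (x.1 : ℂ)) := by
      refine IsSymbol.param (Continuous.continuousOn (by fun_prop)) ⟨T, fun x hx => ?_⟩
      rw [Complex.norm_real, Real.norm_of_nonneg hx.1.1]
      exact hx.1.2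
    have i2 := IsSymbol.exp_disp (n := n) hD (P := Icc 0 T ×ˢ Icc (0 : ℝ) 1)
      (s := fun x => x.1 * (1 - x.2)) (Continuous.continuousOn (by fun_prop)) b3
    have i3 := hA.comp (P' := Icc 0 T ×ˢ Icc (0 : ℝ) 1) (h := fun x => x.1 * x.2)
      (Continuous.continuousOn (by fun_prop)) b2
    have := i1.mul (i2.mul i3)
    simpa using this
  exact ((h1.const_mul κ).add (h2.integral_param.const_mul μ)).congr fun z _ t _ => (e z t).symm

/-- The equation `E_t = μ A - ω E` generates all `t`-derivatives recursively; multiplication by `ω`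
costs the three orders that `IsAmplitude` allows. -/
lemma IsAmplitude.evolve (hD : ∀ z ∈ cone D, (LinearKdV.disp z).re = 0)
    (hA : IsAmplitude D n p A) (κ μ : ℂ) : IsAmplitude D n p (LinearKdV.evolve κ μ A) := by
  obtain ⟨K, h0, h1, h2⟩ := id hA
  let L : ℕ → ℂ → ℝ → ℂ := fun m => Nat.rec (LinearKdV.evolve κ μ A)
    (fun m L z t => μ * K m z t - LinearKdV.disp z * L z t) m
  refine ⟨L, fun _ _ _ _ => rfl, fun m => ?_, fun m T => ?_⟩
  · induction m with
    | zero =>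
      intro z hz t ht
      have := hasDerivAt_evolve (κ := κ) (μ := μ) (hA.continuousOn_time hz) ht
      rw [← h0 z hz t ht.le] at this
      exact this
    | succ m ih =>
      intro z hz t ht
      exact ((h1 m z hz t ht).const_mul μ).sub ((ih z hz t ht).const_mul (LinearKdV.disp z))
  · induction m with
    | zero =>
      refine IsSymbol.evolve hD ?_
      have := h2 0 T
      simp only [Nat.cast_zero, mul_zero, add_zero] at this ⊢
      exact this.congr fun z hz t ht => h0 z hz t ht.1
    | succ m ih =>
      have i1 := ((h2 m T).const_mul μ).mono (q := p + 3 * ((m + 1 : ℕ) : ℤ)) (by push_cast; lia)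
      have i2 := ((IsSymbol.disp.mul ih).const_mul (-1)).mono
        (q := p + 3 * ((m + 1 : ℕ) : ℤ)) (by push_cast; lia)
      exact (i1.add i2).congr fun z _ t _ => by simp only [L]; ring

end

section

/-! ### Integrals along rays -/

/-- `∫₀^∞ F(r d) d dr`, the integral of `F` along the ray in the direction `d`. -/
noncomputable def rayIntegral (d : ℂ) (F : ℂ → ℂ) : ℂ := ∫ r in Ioi (0 : ℝ), F (r * d) * d

/-- The weight `e^{-r x₀ Im d} (1 + r) ^ p` is integrable on `(0, ∞)` for every `x₀ > 0`. -/
def WeightIntegrable (d : ℂ) (p : ℤ) : Prop :=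
  ∀ x₀ : ℝ, 0 < x₀ →
    IntegrableOn (fun r : ℝ => Real.exp (-(r * x₀ * d.im)) * (1 + r) ^ p) (Ioi 0)

lemma WeightIntegrable.mono {d : ℂ} {p q : ℤ} (h : WeightIntegrable d q) (hpq : p ≤ q) :
    WeightIntegrable d p := by
  intro x₀ hx₀
  refine Integrable.mono' (h x₀ hx₀) ?_ ?_
  · refine ContinuousOn.aestronglyMeasurable ?_ measurableSet_Ioi
    refine ContinuousOn.mul (by fun_prop) (ContinuousOn.zpow₀ (by fun_prop) _ fun r hr => ?_)
    exact Or.inl (by have : (0 : ℝ) < r := hr; positivity)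
  · filter_upwards [ae_restrict_mem measurableSet_Ioi] with r hr
    have hr' : (0 : ℝ) < r := hr
    have h1 : (1 : ℝ) ≤ 1 + r := by linarith
    rw [Real.norm_of_nonneg (by positivity)]
    gcongr

variable {ι : Type*} [TopologicalSpace ι] {D : Set ℂ} {P : Set ι} {n : ℕ} {p : ℤ} {d : ℂ}
  {H H' : ℂ → ι → ℂ}

lemma norm_exp_ray_le (him : 0 ≤ d.im) {x₀ x r : ℝ} (hx : x₀ ≤ x) (hr : 0 ≤ r) :
    ‖Complex.exp (Complex.I * (r * d) * x)‖ ≤ Real.exp (-(r * x₀ * d.im)) := by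
  rw [Complex.norm_exp]
  apply Real.exp_le_exp.2
  have e : (Complex.I * (r * d) * x).re = -(r * x * d.im) := by
    simp
    ring
  rw [e]
  gcongr

lemma norm_rayIntegrand_le (hd1 : ‖d‖ = 1) (him : 0 ≤ d.im) {C : ℝ} {x₀ x r : ℝ}
    (hx : x₀ ≤ x) (hr : 0 ≤ r) {c : ℂ} (hc : ‖c‖ ≤ C * (1 + ‖(r : ℂ) * d‖) ^ p) :
    ‖Complex.exp (Complex.I * (r * d) * x) * c * d‖ ≤
      C * (Real.exp (-(r * x₀ * d.im)) * (1 + r) ^ p) := by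
  have e : ‖(r : ℂ) * d‖ = r := by rw [norm_mul, hd1, mul_one, Complex.norm_real,
    Real.norm_of_nonneg hr]
  rw [e] at hc
  rw [norm_mul, hd1, mul_one, norm_mul, mul_left_comm C]
  exact mul_le_mul (norm_exp_ray_le him hx hr) hc (norm_nonneg _) (Real.exp_pos _).le

lemma PolyBounded.continuousOn_ray (hH : PolyBounded (cone D) P p H) (hd : d ∈ D) (x : ℝ) {q : ι}
    (hq : q ∈ P) :
    ContinuousOn (fun r : ℝ => Complex.exp (Complex.I * (r * d) * x) * H (r * d) q) (Ici 0) := by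
  refine ContinuousOn.mul (by fun_prop) ?_
  exact hH.1.comp (f := fun r : ℝ => ((r : ℂ) * d, q)) (by fun_prop) fun r hr =>
    ⟨mem_cone hd hr, hq⟩

lemma PolyBounded.aestronglyMeasurable_ray (hH : PolyBounded (cone D) P p H) (hd : d ∈ D) (x : ℝ)
    {q : ι} (hq : q ∈ P) :
    AEStronglyMeasurable (fun r : ℝ => Complex.exp (Complex.I * (r * d) * x) * H (r * d) q * d)
      (volume.restrict (Ioi 0)) :=
  (((hH.continuousOn_ray hd x hq).mono Ioi_subset_Ici_self).mul
    continuousOn_const).aestronglyMeasurable measurableSet_Ioi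

lemma PolyBounded.integrableOn_ray (hH : PolyBounded (cone D) P p H) (hd : d ∈ D) (hd1 : ‖d‖ = 1)
    (him : 0 ≤ d.im) (hw : WeightIntegrable d p) {x : ℝ} (hx : 0 < x) {q : ι} (hq : q ∈ P) :
    IntegrableOn (fun r : ℝ => Complex.exp (Complex.I * (r * d) * x) * H (r * d) q * d)
      (Ioi 0) := by
  obtain ⟨C, hC, hb⟩ := hH.2
  refine Integrable.mono' ((hw x hx).const_mul C) (hH.aestronglyMeasurable_ray hd x hq) ?_
  filter_upwards [ae_restrict_mem measurableSet_Ioi] with r hr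
  exact norm_rayIntegrand_le hd1 him le_rfl (le_of_lt hr) (hb _ (mem_cone hd (le_of_lt hr)) _ hq)

lemma PolyBounded.rayIntegral_bound (hH : PolyBounded (cone D) P p H) (hd : d ∈ D)
    (hd1 : ‖d‖ = 1) (him : 0 ≤ d.im) (hw : WeightIntegrable d p) {x₀ : ℝ} (hx₀ : 0 < x₀) :
    ∃ C : ℝ, ∀ x, x₀ ≤ x → ∀ q ∈ P,
      ‖rayIntegral d (fun z => Complex.exp (Complex.I * z * x) * H z q)‖ ≤ C := by
  obtain ⟨C, hC, hb⟩ := hH.2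
  refine ⟨_, fun x hx q hq => norm_integral_le_of_norm_le ((hw x₀ hx₀).const_mul C) ?_⟩
  filter_upwards [ae_restrict_mem measurableSet_Ioi] with r hr
  exact norm_rayIntegrand_le hd1 him hx (le_of_lt hr) (hb _ (mem_cone hd (le_of_lt hr)) _ hq)

/-- Integration by parts along a ray. -/
lemma PolyBounded.rayIntegral_by_parts {p' : ℤ} (hH : PolyBounded (cone D) P p H)
    (hH' : PolyBounded (cone D) P p' H') (hd : d ∈ D) (hd1 : ‖d‖ = 1) (him : 0 ≤ d.im)
    (hw : WeightIntegrable d p) (hw' : WeightIntegrable d p') {q : ι} (hq : q ∈ P)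
    (hder : ∀ r : ℝ, 0 < r → HasDerivAt (fun s : ℝ => H (s * d) q) (d * H' (r * d) q) r)
    {x : ℝ} (hx : 0 < x) :
    x * rayIntegral d (fun z => Complex.exp (Complex.I * z * x) * H z q) =
      Complex.I * H 0 q +
        Complex.I * rayIntegral d (fun z => Complex.exp (Complex.I * z * x) * H' z q) := by
  have i0 := hH.integrableOn_ray hd hd1 him hw hx hq
  have i1 := hH'.integrableOn_ray hd hd1 him hw' hx hq
  have hd0 : d ≠ 0 := by rintro rfl; simp at hd1
  have hder' : ∀ r ∈ Ioi (0 : ℝ), HasDerivAt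
      (fun r : ℝ => Complex.exp (Complex.I * (r * d) * x) * H (r * d) q)
      (Complex.I * x * (Complex.exp (Complex.I * (r * d) * x) * H (r * d) q * d) +
        Complex.exp (Complex.I * (r * d) * x) * H' (r * d) q * d) r := by
    intro r hr
    refine ((((hasDerivAt_ray d r).const_mul Complex.I).mul_const (x : ℂ)).cexp.mul
      (hder r hr)).congr_deriv ?_
    ring
  have i2 := (i0.const_mul (Complex.I * x)).add i1
  have i3 : IntegrableOn (fun r : ℝ => Complex.exp (Complex.I * (r * d) * x) * H (r * d) q)
      (Ioi 0) := by
    have i4 : IntegrableOn (fun r : ℝ => Complex.exp (Complex.I * (r * d) * x) * H (r * d) q * d *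
      d⁻¹) (Ioi 0) := i0.mul_const d⁻¹
    refine i4.congr_fun (fun r _ => ?_) measurableSet_Ioi
    field_simp
  -- The endpoint contributes the value at `0`, in which the direction `d` does not appear: the `d`
  -- of the ray derivative of `H` is the one in `dz = d dr`. Hence these terms cancel between two
  -- rays.
  have key := integral_Ioi_of_hasDerivAt_of_tendsto
    (hH.continuousOn_ray hd x hq 0 self_mem_Ici) hder' i2
    (tendsto_zero_of_hasDerivAt_of_integrableOn_Ioi hder' i2 i3)
  rw [integral_add (i0.const_mul _) i1, integral_const_mul] at key
  simp only [Complex.ofReal_zero, zero_mul, mul_zero, Complex.exp_zero, one_mul, zero_sub] at key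
  simp only [rayIntegral]
  linear_combination -Complex.I * key +
    x * (∫ r in Ioi (0 : ℝ), Complex.exp (Complex.I * (r * d) * x) * H (r * d) q * d) *
      Complex.I_sq

lemma PolyBounded.hasDerivAt_rayIntegral_space (hH : PolyBounded (cone D) P p H)
    (hd : d ∈ D) (hd1 : ‖d‖ = 1) (him : 0 ≤ d.im) (hw : WeightIntegrable d (1 + p)) {q : ι}
    (hq : q ∈ P) {x : ℝ} (hx : 0 < x) :
    HasDerivAt (fun x : ℝ => rayIntegral d (fun z => Complex.exp (Complex.I * z * x) * H z q))
      (rayIntegral d (fun z => Complex.exp (Complex.I * z * x) * (Complex.I * z * H z q))) x := by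
  have hH' : PolyBounded (cone D) P (1 + p) (fun z q => Complex.I * z * H z q) := by
    have h1 : IsSymbol D P 0 1 (fun z _ => Complex.I * z) := IsSymbol.id.const_mul _
    exact h1.polyBounded.mul hH
  obtain ⟨C, hC, hb⟩ := hH'.2
  refine (hasDerivAt_integral_of_dominated_loc_of_deriv_le
    (μ := volume.restrict (Ioi (0 : ℝ))) (𝕜 := ℝ) (x₀ := x)
    (F := fun x r => Complex.exp (Complex.I * (r * d) * x) * H (r * d) q * d)
    (F' := fun x r => Complex.exp (Complex.I * (r * d) * x) *
      (Complex.I * (r * d) * H (r * d) q) * d)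
    (bound := fun r => C * (Real.exp (-(r * (x / 2) * d.im)) * (1 + r) ^ (1 + p)))
    (s := Ioi (x / 2)) (Ioi_mem_nhds (half_lt_self hx))
    (Eventually.of_forall fun y => hH.aestronglyMeasurable_ray hd y hq)
    (hH.integrableOn_ray hd hd1 him (hw.mono (by lia)) hx hq)
    (hH'.aestronglyMeasurable_ray hd x hq) ?_ ((hw (x / 2) (half_pos hx)).const_mul C) ?_).2
  · filter_upwards [ae_restrict_mem measurableSet_Ioi] with r hr y hy
    exact norm_rayIntegrand_le hd1 him (le_of_lt hy) (le_of_lt hr)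
      (hb _ (mem_cone hd (le_of_lt hr)) _ hq)
  · refine Eventually.of_forall fun r y _ => ?_
    have := (((Complex.ofRealCLM.hasDerivAt (x := y)).const_mul
      (Complex.I * (r * d))).cexp.mul_const (H (r * d) q)).mul_const d
    refine this.congr_deriv ?_
    simp only [Complex.ofRealCLM_apply, Complex.ofReal_one]
    ring

lemma hasDerivAt_rayIntegral_time {H H' : ℂ → ℝ → ℂ} {p' : ℤ}
    (hH : ∀ T, PolyBounded (cone D) (Icc 0 T) p H)
    (hH' : ∀ T, PolyBounded (cone D) (Icc 0 T) p' H') (hd : d ∈ D) (hd1 : ‖d‖ = 1)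
    (him : 0 ≤ d.im) (hw : WeightIntegrable d p) (hw' : WeightIntegrable d p')
    (hder : ∀ z ∈ cone D, ∀ t : ℝ, 0 < t → HasDerivAt (H z) (H' z t) t) {x t : ℝ} (hx : 0 < x)
    (ht : 0 < t) :
    HasDerivAt (fun t : ℝ => rayIntegral d (fun z => Complex.exp (Complex.I * z * x) * H z t))
      (rayIntegral d (fun z => Complex.exp (Complex.I * z * x) * H' z t)) t := by
  obtain ⟨C, hC, hb⟩ := (hH' (t + 1)).2
  have hmem : Ioo 0 (t + 1) ∈ 𝓝 t := isOpen_Ioo.mem_nhds ⟨ht, lt_add_one t⟩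
  refine (hasDerivAt_integral_of_dominated_loc_of_deriv_le
    (μ := volume.restrict (Ioi (0 : ℝ))) (𝕜 := ℝ) (x₀ := t)
    (F := fun t r => Complex.exp (Complex.I * (r * d) * x) * H (r * d) t * d)
    (F' := fun t r => Complex.exp (Complex.I * (r * d) * x) * H' (r * d) t * d)
    (bound := fun r => C * (Real.exp (-(r * x * d.im)) * (1 + r) ^ p'))
    (s := Ioo 0 (t + 1)) hmem ?_
    ((hH t).integrableOn_ray hd hd1 him hw hx ⟨ht.le, le_rfl⟩)
    ((hH' t).aestronglyMeasurable_ray hd x ⟨ht.le, le_rfl⟩) ?_ ((hw' x hx).const_mul C) ?_).2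
  · filter_upwards [hmem] with s hs
    exact (hH (t + 1)).aestronglyMeasurable_ray hd x ⟨hs.1.le, hs.2.le⟩
  · filter_upwards [ae_restrict_mem measurableSet_Ioi] with r hr s hs
    exact norm_rayIntegrand_le hd1 him le_rfl (le_of_lt hr)
      (hb _ (mem_cone hd (le_of_lt hr)) _ ⟨hs.1.le, hs.2.le⟩)
  · filter_upwards [ae_restrict_mem measurableSet_Ioi] with r hr s hs
    exact ((hder _ (mem_cone hd (le_of_lt hr)) s hs.1).const_mul _).mul_const _

/-! ### Decay of integrals over a pair of rays -/

variable {a b : ℂ}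

/-- Integrals over a pair of rays of a symbol against `e^{izx}` decay rapidly, as the boundary terms
at the common endpoint cancel. -/
lemma IsSymbol.pairIntegral_decay (ha : ‖a‖ = 1) (hb : ‖b‖ = 1) (ha' : 0 ≤ a.im) (hb' : 0 ≤ b.im)
    {l : ℕ} (hl : l ≤ n) (hH : IsSymbol {a, b} P n p H) (wa : WeightIntegrable a (p + 2 * l))
    (wb : WeightIntegrable b (p + 2 * l)) {x₀ : ℝ} (hx₀ : 0 < x₀) :
    ∃ C : ℝ, ∀ x : ℝ, x₀ ≤ x → ∀ q ∈ P,
      ‖(x : ℂ) ^ l * (rayIntegral a (fun z => Complex.exp (Complex.I * z * x) * H z q) -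
        rayIntegral b (fun z => Complex.exp (Complex.I * z * x) * H z q))‖ ≤ C := by
  have haD : a ∈ ({a, b} : Set ℂ) := Or.inl rfl
  have hbD : b ∈ ({a, b} : Set ℂ) := Or.inr rfl
  induction l generalizing n p H with
  | zero =>
    simp only [Nat.cast_zero, mul_zero, add_zero] at wa wb
    obtain ⟨C, hC⟩ := hH.polyBounded.rayIntegral_bound haD ha ha' wa hx₀
    obtain ⟨C', hC'⟩ := hH.polyBounded.rayIntegral_bound hbD hb hb' wb hx₀
    refine ⟨C + C', fun x hx q hq => ?_⟩
    rw [pow_zero, one_mul]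
    exact norm_sub_le_of_le (hC x hx q hq) (hC' x hx q hq)
  | succ l ih =>
    obtain ⟨n, rfl⟩ : ∃ k, n = k + 1 := ⟨n - 1, by lia⟩
    obtain ⟨h0, H', hd, h'⟩ := hH
    push_cast at wa wb
    obtain ⟨C, hC⟩ := ih (by lia) h' (wa.mono (by lia)) (wb.mono (by lia))
    refine ⟨C, fun x hx q hq => ?_⟩
    have hx0 : 0 < x := hx₀.trans_le hx
    have ea := h0.rayIntegral_by_parts h'.polyBounded haD ha ha' (wa.mono (by lia))
      (wa.mono (by lia)) hq (fun r hr => hd a haD r hr q hq) hx0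
    have eb := h0.rayIntegral_by_parts h'.polyBounded hbD hb hb' (wb.mono (by lia))
      (wb.mono (by lia)) hq (fun r hr => hd b hbD r hr q hq) hx0
    have key : (x : ℂ) ^ (l + 1) *
        (rayIntegral a (fun z => Complex.exp (Complex.I * z * x) * H z q) -
          rayIntegral b (fun z => Complex.exp (Complex.I * z * x) * H z q)) =
        Complex.I * ((x : ℂ) ^ l *
          (rayIntegral a (fun z => Complex.exp (Complex.I * z * x) * H' z q) -
            rayIntegral b (fun z => Complex.exp (Complex.I * z * x) * H' z q))) := by
      linear_combination (x : ℂ) ^ l * (ea - eb)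
    rw [key, norm_mul, Complex.norm_I, one_mul]
    exact hC x hx q hq

/-- The witness for `∂_x^k ∂_t^m` carries the amplitude `(iz)^k ∂_t^m F`, of order `p + k + 3m`, and
`l` integrations by parts add `2l`. With `k, m ≤ M + 1` and `l ≤ M` the worst order is `p + 6M + 4`.
-/
lemma IsAmplitude.decaysUpTo (ha : ‖a‖ = 1) (hb : ‖b‖ = 1) (ha' : 0 ≤ a.im) (hb' : 0 ≤ b.im)
    {M : ℕ} (hM : M ≤ n) {F : ℂ → ℝ → ℂ} (hF : IsAmplitude {a, b} n p F)
    (wa : WeightIntegrable a (p + 6 * M + 4)) (wb : WeightIntegrable b (p + 6 * M + 4)) :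
    DecaysUpTo M (fun x t =>
      rayIntegral a (fun z => Complex.exp (Complex.I * z * x) * F z t) -
        rayIntegral b (fun z => Complex.exp (Complex.I * z * x) * F z t)) := by
  have haD : a ∈ ({a, b} : Set ℂ) := Or.inl rfl
  have hbD : b ∈ ({a, b} : Set ℂ) := Or.inr rfl
  obtain ⟨G, h0, h1, h2⟩ := hF
  have hS : ∀ (k m : ℕ) (T : ℝ), IsSymbol {a, b} (Icc 0 T) n (k + (p + 3 * m))
      (fun z t => (Complex.I * z) ^ k * G m z t) := by
    intro k m T
    have h3 : IsSymbol {a, b} (Icc 0 T) n 1 (fun z _ => Complex.I * z) := IsSymbol.id.const_mul _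
    exact ((h3.pow k).mul (h2 m T)).mono (by lia)
  refine ⟨fun k m x t =>
    rayIntegral a (fun z => Complex.exp (Complex.I * z * x) * ((Complex.I * z) ^ k * G m z t)) -
    rayIntegral b (fun z => Complex.exp (Complex.I * z * x) * ((Complex.I * z) ^ k * G m z t)),
    ?_, ?_, ?_⟩
  · intro x t _ ht
    have e : ∀ d ∈ ({a, b} : Set ℂ),
        rayIntegral d (fun z => Complex.exp (Complex.I * z * x) *
          ((Complex.I * z) ^ 0 * G 0 z t)) =
        rayIntegral d (fun z => Complex.exp (Complex.I * z * x) * F z t) := by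
      intro d hd
      refine setIntegral_congr_fun measurableSet_Ioi fun r hr => ?_
      simp only [pow_zero, one_mul, h0 _ (mem_cone hd (le_of_lt hr)) t ht.le]
    simp only [e a haD, e b hbD]
  · intro k m hk hm x t hx ht
    have dx : ∀ d ∈ ({a, b} : Set ℂ), ‖d‖ = 1 → 0 ≤ d.im → WeightIntegrable d (p + 6 * M + 4) →
        HasDerivAt (fun x : ℝ => rayIntegral d (fun z => Complex.exp (Complex.I * z * x) *
          ((Complex.I * z) ^ k * G m z t)))
          (rayIntegral d (fun z => Complex.exp (Complex.I * z * x) *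
          ((Complex.I * z) ^ (k + 1) * G m z t))) x := by
      intro d hd hd1 him hw
      have := (hS k m t).polyBounded.hasDerivAt_rayIntegral_space hd hd1 him (hw.mono (by lia))
        (⟨ht.le, le_rfl⟩ : t ∈ Icc 0 t) hx
      simpa only [pow_succ', mul_assoc] using this
    have dt : ∀ d ∈ ({a, b} : Set ℂ), ‖d‖ = 1 → 0 ≤ d.im → WeightIntegrable d (p + 6 * M + 4) →
        HasDerivAt (fun t : ℝ => rayIntegral d (fun z => Complex.exp (Complex.I * z * x) *
          ((Complex.I * z) ^ k * G m z t)))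
          (rayIntegral d (fun z => Complex.exp (Complex.I * z * x) *
          ((Complex.I * z) ^ k * G (m + 1) z t))) t := by
      intro d hd hd1 him hw
      exact hasDerivAt_rayIntegral_time (fun T => (hS k m T).polyBounded)
        (fun T => (hS k (m + 1) T).polyBounded) hd hd1 him (hw.mono (by lia))
        (hw.mono (by push_cast; lia)) (fun z hz s hs => (h1 m z hz s hs).const_mul _) hx ht
    exact ⟨(dx a haD ha ha' wa).sub (dx b hbD hb hb' wb),
      (dt a haD ha ha' wa).sub (dt b hbD hb hb' wb)⟩
  · intro k m l hk hm hl x₀ T₀ hx₀ hT₀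
    obtain ⟨C, hC⟩ := (hS k m T₀).pairIntegral_decay ha hb ha' hb' (hl.trans hM)
      (wa.mono (by lia)) (wb.mono (by lia)) hx₀
    exact ⟨C, fun x t hx ht htT => hC x hx t ⟨ht.le, htT⟩⟩

end

section

/-! ### Geometry of the contours -/

lemma exp_pi_mul_I_div_three :
    Complex.exp (Real.pi / 3 * Complex.I) = 1 / 2 + Real.sqrt 3 / 2 * Complex.I := by
  have : (Real.pi : ℂ) / 3 = ((Real.pi / 3 : ℝ) : ℂ) := by push_cast; rfl
  rw [Complex.exp_mul_I, this, ← Complex.ofReal_cos, ← Complex.ofReal_sin, Real.cos_pi_div_three,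
    Real.sin_pi_div_three]
  push_cast
  rfl

lemma rayR_eq : rayR = 1 / 2 + Real.sqrt 3 / 2 * Complex.I := by
  rw [rayR, ← exp_pi_mul_I_div_three]
  congr 1
  ring

lemma ofReal_sqrt_three_sq : ((Real.sqrt 3 : ℝ) : ℂ) ^ 2 = 3 := by
  rw [← Complex.ofReal_pow, Real.sq_sqrt (by norm_num)]; norm_num

lemma alpha_eq : alpha = -1 / 2 + Real.sqrt 3 / 2 * Complex.I := by
  have : alpha = Complex.exp (Real.pi / 3 * Complex.I) ^ 2 := by
    rw [alpha, ← Complex.exp_nat_mul]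
    congr 1
    push_cast
    ring
  rw [this, exp_pi_mul_I_div_three]
  linear_combination (Complex.I ^ 2 / 4) * ofReal_sqrt_three_sq + 3 / 4 * Complex.I_sq

lemma rayL_eq : rayL = -1 / 2 + Real.sqrt 3 / 2 * Complex.I := alpha_eq

lemma rayR_re : rayR.re = 1 / 2 := by simp [rayR_eq]
lemma rayR_im : rayR.im = Real.sqrt 3 / 2 := by simp [rayR_eq]
lemma rayL_re : rayL.re = -1 / 2 := by simp [rayL_eq]
lemma rayL_im : rayL.im = Real.sqrt 3 / 2 := by simp [rayL_eq]

lemma norm_rayR : ‖rayR‖ = 1 := by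
  have : rayR = Complex.exp ((Real.pi / 3 : ℝ) * Complex.I) := by
    rw [rayR]; congr 1; push_cast; ring
  rw [this, Complex.norm_exp_ofReal_mul_I]

lemma norm_rayL : ‖rayL‖ = 1 := by
  have : rayL = Complex.exp ((2 * Real.pi / 3 : ℝ) * Complex.I) := by
    rw [rayL]; congr 1; push_cast; ring
  rw [this, Complex.norm_exp_ofReal_mul_I]

/-- The part `Im z ≥ 0`, `Re ω(z) ≥ 0` of the plane, which lies between `ℝ` and `Γ`. -/
def sector : Set ℂ := {z | 0 ≤ z.im ∧ z.im ^ 2 ≤ 3 * z.re ^ 2}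

lemma disp_re (z : ℂ) : (disp z).re = z.im * (3 * z.re ^ 2 - z.im ^ 2) := by
  simp [disp, pow_succ]
  ring

lemma disp_re_nonneg {z : ℂ} (hz : z ∈ sector) : 0 ≤ (disp z).re := by
  rw [disp_re]
  exact mul_nonneg hz.1 (by linarith [hz.2])

/-- The sector stays away from the zero `i` of `1 + iz`. There `Im z ≤ (√3/2)|z| ≤ (9/10)|z|`, so
`|1 + iz|² = 1 - 2 Im z + |z|² ≥ (1 + |z|)²/20`, and `1/20 > 1/25`. -/
lemma sector_lower_bound {z : ℂ} (hz : z ∈ sector) :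
    1 / 5 * (1 + ‖z‖) ≤ ‖1 + Complex.I * z‖ := by
  obtain ⟨h1, h2⟩ := hz
  have e1 : ‖z‖ ^ 2 = z.re ^ 2 + z.im ^ 2 := by
    rw [Complex.sq_norm, Complex.normSq_apply]; ring
  have e2 : ‖1 + Complex.I * z‖ ^ 2 = (1 - z.im) ^ 2 + z.re ^ 2 := by
    rw [Complex.sq_norm, Complex.normSq_apply]; simp; ring
  have h3 : z.im ≤ 9 / 10 * ‖z‖ := by
    refine le_of_sq_le_sq ?_ (by positivity)
    nlinarith
  refine le_of_sq_le_sq ?_ (norm_nonneg _)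
  rw [e2]
  nlinarith [sq_nonneg (‖z‖ - 1), norm_nonneg z]

lemma one_add_I_mul_ne_zero {z : ℂ} (hz : z ∈ sector) : 1 + Complex.I * z ≠ 0 := by
  have := sector_lower_bound hz
  exact norm_pos_iff.1 (lt_of_lt_of_le (by positivity) this)

lemma ofReal_mem_sector (s : ℝ) : (s : ℂ) ∈ sector := by
  refine ⟨by simp, ?_⟩
  simp only [Complex.ofReal_im, Complex.ofReal_re]
  nlinarith [sq_nonneg s]

lemma mem_cone_line {z : ℂ} : z ∈ cone {1, -1} ↔ ∃ s : ℝ, z = s := by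
  constructor
  · rintro ⟨d, rfl | rfl, r, -, rfl⟩
    · exact ⟨r, by simp⟩
    · exact ⟨-r, by simp⟩
  · rintro ⟨s, rfl⟩
    rcases le_total 0 s with hs | hs
    · exact ⟨1, Or.inl rfl, s, hs, by simp⟩
    · exact ⟨-1, Or.inr rfl, -s, by linarith, by simp⟩

lemma cone_line_subset_sector : cone {1, -1} ⊆ sector := by
  intro z hz
  obtain ⟨s, rfl⟩ := mem_cone_line.1 hz
  exact ofReal_mem_sector s

lemma mem_cone_gamma {z : ℂ} (hz : z ∈ cone {rayR, rayL}) :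
    0 ≤ z.im ∧ z.im ^ 2 = 3 * z.re ^ 2 := by
  have h3 : Real.sqrt 3 ^ 2 = 3 := Real.sq_sqrt (by norm_num)
  obtain ⟨d, rfl | rfl, r, hr, rfl⟩ := hz
  · simp only [Complex.im_ofReal_mul, Complex.re_ofReal_mul, rayR_re, rayR_im]
    refine ⟨by positivity, ?_⟩
    linear_combination (r ^ 2 / 4) * h3
  · simp only [Complex.im_ofReal_mul, Complex.re_ofReal_mul, rayL_re, rayL_im]
    refine ⟨by positivity, ?_⟩
    linear_combination (r ^ 2 / 4) * h3

lemma cone_gamma_subset_sector : cone {rayR, rayL} ⊆ sector := fun _ hz =>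
  ⟨(mem_cone_gamma hz).1, (mem_cone_gamma hz).2.le⟩

lemma disp_re_gamma : ∀ z ∈ cone {rayR, rayL}, (disp z).re = 0 := by
  intro z hz
  rw [disp_re, (mem_cone_gamma hz).2]
  ring

lemma disp_re_line : ∀ z ∈ cone {1, -1}, (disp z).re = 0 := by
  intro z hz
  obtain ⟨s, rfl⟩ := mem_cone_line.1 hz
  simp [disp_re]

/-- The rotation takes the arguments `π/3`, `2π/3` to `π`, `4π/3`, where the half-line transform is
defined. -/
lemma alpha_mul_im_nonpos : ∀ z ∈ cone {rayR, rayL}, (alpha * z).im ≤ 0 := by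
  have h3 : Real.sqrt 3 * Real.sqrt 3 = 3 := Real.mul_self_sqrt (by norm_num)
  rintro z ⟨d, rfl | rfl, r, hr, rfl⟩
  · simp only [Complex.mul_im, alpha_eq, rayR_eq]
    simp
    ring_nf
    exact le_rfl
  · simp only [Complex.mul_im, alpha_eq, rayL_eq]
    simp
    nlinarith [mul_nonneg (Real.sqrt_nonneg 3) hr]

/-- Here the arguments become `5π/3` and `2π`. -/
lemma alpha_sq_mul_im_nonpos : ∀ z ∈ cone {rayR, rayL}, (alpha ^ 2 * z).im ≤ 0 := by
  have h3 : Real.sqrt 3 * Real.sqrt 3 = 3 := Real.mul_self_sqrt (by norm_num)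
  have e : alpha ^ 2 = -1 / 2 - Real.sqrt 3 / 2 * Complex.I := by
    rw [alpha_eq]
    linear_combination (Complex.I ^ 2 / 4) * ofReal_sqrt_three_sq + 3 / 4 * Complex.I_sq
  rintro z ⟨d, rfl | rfl, r, hr, rfl⟩
  · simp only [Complex.mul_im, e, rayR_eq]
    simp
    nlinarith [mul_nonneg (Real.sqrt_nonneg 3) hr]
  · simp only [Complex.mul_im, e, rayL_eq]
    simp
    ring_nf
    exact le_rfl

/-! ### Integrability of the weights -/

lemma weightIntegrable_of_im_pos {d : ℂ} (hd : 0 < d.im) (p : ℤ) : WeightIntegrable d p := by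
  refine WeightIntegrable.mono (q := (p.toNat : ℤ)) ?_ (Int.self_le_toNat p)
  intro x₀ hx₀
  set N := p.toNat
  -- Half of the exponential rate absorbs the polynomial, via `y^N / N! ≤ e^y`; the other half
  -- remains for integrability.
  set c := x₀ * d.im / 2 with hc
  have hc0 : 0 < c := by positivity
  refine Integrable.mono' ((exp_neg_integrableOn_Ioi 0 hc0).const_mul
    (N.factorial * (c⁻¹) ^ N * Real.exp c)) ?_ ?_
  · refine ContinuousOn.aestronglyMeasurable ?_ measurableSet_Ioi
    simp only [zpow_natCast]
    fun_prop
  · filter_upwards [ae_restrict_mem measurableSet_Ioi] with r hr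
    have hr' : (0 : ℝ) < r := hr
    rw [zpow_natCast, Real.norm_of_nonneg (by positivity)]
    have h1 := Real.pow_div_factorial_le_exp (c * (1 + r)) (by positivity) N
    rw [div_le_iff₀ (by positivity), mul_pow] at h1
    have h2 : (1 + r) ^ N ≤ (c⁻¹) ^ N * (Real.exp (c * (1 + r)) * N.factorial) := by
      rw [inv_pow, ← div_eq_inv_mul, le_div_iff₀ (by positivity)]
      linarith
    calc Real.exp (-(r * x₀ * d.im)) * (1 + r) ^ N
        ≤ Real.exp (-(r * x₀ * d.im)) * ((c⁻¹) ^ N * (Real.exp (c * (1 + r)) * N.factorial)) := by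
          gcongr
      _ = N.factorial * (c⁻¹) ^ N *
          (Real.exp (-(r * x₀ * d.im)) * Real.exp (c * (1 + r))) := by ring
      _ = N.factorial * (c⁻¹) ^ N * (Real.exp c * Real.exp (-c * r)) := by
          rw [← Real.exp_add, ← Real.exp_add]
          congr 2
          rw [hc]
          ring
      _ = _ := by ring

lemma weightIntegrable_rayR (p : ℤ) : WeightIntegrable rayR p :=
  weightIntegrable_of_im_pos (by rw [rayR_im]; positivity) p

lemma weightIntegrable_rayL (p : ℤ) : WeightIntegrable rayL p :=
  weightIntegrable_of_im_pos (by rw [rayL_im]; positivity) p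

lemma weightIntegrable_of_im_eq_zero {d : ℂ} (hd : d.im = 0) {p : ℤ} (hp : p ≤ -2) :
    WeightIntegrable d p := by
  refine WeightIntegrable.mono (q := -2) ?_ hp
  intro x₀ _
  refine Integrable.mono' (integrable_inv_one_add_sq.integrableOn) ?_ ?_
  · refine ContinuousOn.aestronglyMeasurable ?_ measurableSet_Ioi
    refine ContinuousOn.mul (by fun_prop) (ContinuousOn.zpow₀ (by fun_prop) _ fun r hr => ?_)
    exact Or.inl (by have : (0 : ℝ) < r := hr; positivity)
  · filter_upwards [ae_restrict_mem measurableSet_Ioi] with r hr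
    have hr' : (0 : ℝ) < r := hr
    rw [hd, mul_zero, neg_zero, Real.exp_zero, one_mul, Real.norm_of_nonneg (by positivity),
      zpow_neg]
    refine inv_anti₀ (by positivity) ?_
    norm_cast
    nlinarith

end

section

/-! ### Rotating rays of integration -/

lemma continuousOn_polar_ray {F : ℂ → ℂ} {θ : ℝ}
    (hF : ∀ r : ℝ, 0 ≤ r → DifferentiableAt ℂ F (r * Complex.exp (θ * Complex.I))) :
    ContinuousOn (fun r : ℝ => F (r * Complex.exp (θ * Complex.I)) * Complex.exp (θ * Complex.I))
      (Ici 0) := by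
  intro r hr
  refine ContinuousAt.continuousWithinAt (ContinuousAt.mul ?_ continuousAt_const)
  exact ContinuousAt.comp (f := fun r : ℝ => (r : ℂ) * Complex.exp (θ * Complex.I))
    (hF r hr).continuousAt (by fun_prop)

/-- Cauchy's theorem for an annular sector. -/
lemma annular_sector_cauchy {F : ℂ → ℂ} {θ₁ θ₂ ε R : ℝ} (hθ : θ₁ ≤ θ₂) (hε : 0 < ε) (hR : ε ≤ R)
    (hF : ∀ r : ℝ, 0 ≤ r → ∀ θ ∈ Icc θ₁ θ₂,
      DifferentiableAt ℂ F (r * Complex.exp (θ * Complex.I))) :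
    (∫ r in ε..R, F (r * Complex.exp (θ₁ * Complex.I)) * Complex.exp (θ₁ * Complex.I)) -
      (∫ r in ε..R, F (r * Complex.exp (θ₂ * Complex.I)) * Complex.exp (θ₂ * Complex.I)) +
      Complex.I * (∫ θ in θ₁..θ₂,
        F (R * Complex.exp (θ * Complex.I)) * (R * Complex.exp (θ * Complex.I))) -
      Complex.I * (∫ θ in θ₁..θ₂,
        F (ε * Complex.exp (θ * Complex.I)) * (ε * Complex.exp (θ * Complex.I))) = 0 := by
  have hR0 : 0 < R := hε.trans_le hR
  have polar : ∀ x θ : ℝ, Complex.exp (x + θ * Complex.I) =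
      (Real.exp x : ℝ) * Complex.exp (θ * Complex.I) := by
    intro x θ
    rw [Complex.exp_add, Complex.ofReal_exp]
  -- In logarithmic coordinates `z = e^w` the annular sector is a rectangle, and `dz = e^w dw`.
  have key := Complex.integral_boundary_rect_eq_zero_of_differentiableOn
    (fun w => F (Complex.exp w) * Complex.exp w) ⟨Real.log ε, θ₁⟩ ⟨Real.log R, θ₂⟩ (by
      intro w hw
      have hw2 : w.im ∈ Icc θ₁ θ₂ := by simpa [uIcc_of_le hθ] using hw.2
      refine DifferentiableAt.differentiableWithinAt ?_
      refine DifferentiableAt.mul ?_ Complex.differentiableAt_exp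
      refine DifferentiableAt.comp w ?_ Complex.differentiableAt_exp
      have := hF (Real.exp w.re) (Real.exp_pos _).le w.im hw2
      rwa [← polar, Complex.re_add_im] at this)
  have sub : ∀ θ ∈ Icc θ₁ θ₂, (∫ x : ℝ in Real.log ε..Real.log R,
      F (Complex.exp (x + θ * Complex.I)) * Complex.exp (x + θ * Complex.I)) =
      ∫ r in ε..R, F (r * Complex.exp (θ * Complex.I)) * Complex.exp (θ * Complex.I) := by
    intro θ hθm
    have h := intervalIntegral.integral_deriv_smul_comp' (a := Real.log ε) (b := Real.log R)
      (f := Real.exp) (f' := Real.exp)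
      (g := fun r : ℝ => F (r * Complex.exp (θ * Complex.I)) * Complex.exp (θ * Complex.I))
      (fun x _ => Real.hasDerivAt_exp x) Real.continuous_exp.continuousOn
      ((continuousOn_polar_ray fun r hr => hF r hr θ hθm).mono (by
        rintro _ ⟨x, _, rfl⟩
        exact (Real.exp_pos x).le))
    rw [Real.exp_log hε, Real.exp_log hR0] at h
    rw [← h]
    refine intervalIntegral.integral_congr fun x _ => ?_
    simp only [polar, Function.comp, Complex.real_smul]
    ring
  simp only [smul_eq_mul] at key
  rw [sub θ₁ ⟨le_rfl, hθ⟩, sub θ₂ ⟨hθ, le_rfl⟩] at key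
  simp only [polar, Real.exp_log hε, Real.exp_log hR0] at key
  exact key

/-- The inner radius of the annular sector tends to `0`. Since `F` is bounded near `0`, the inner
arc contributes `O(ε)`. -/
lemma sector_cauchy {F : ℂ → ℂ} {θ₁ θ₂ R : ℝ} (hθ : θ₁ ≤ θ₂) (hR : 0 < R)
    (hF : ∀ r : ℝ, 0 ≤ r → ∀ θ ∈ Icc θ₁ θ₂,
      DifferentiableAt ℂ F (r * Complex.exp (θ * Complex.I))) :
    (∫ r in (0 : ℝ)..R, F (r * Complex.exp (θ₁ * Complex.I)) * Complex.exp (θ₁ * Complex.I)) -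
      (∫ r in (0 : ℝ)..R, F (r * Complex.exp (θ₂ * Complex.I)) * Complex.exp (θ₂ * Complex.I)) +
      Complex.I * (∫ θ in θ₁..θ₂,
        F (R * Complex.exp (θ * Complex.I)) * (R * Complex.exp (θ * Complex.I))) = 0 := by
  have lim : ∀ θ ∈ Icc θ₁ θ₂, Tendsto (fun ε : ℝ => ∫ r in ε..R,
      F (r * Complex.exp (θ * Complex.I)) * Complex.exp (θ * Complex.I)) (𝓝[>] 0)
      (𝓝 (∫ r in (0 : ℝ)..R,
        F (r * Complex.exp (θ * Complex.I)) * Complex.exp (θ * Complex.I))) := by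
    intro θ hθm
    have hc := (continuousOn_polar_ray fun r hr => hF r hr θ hθm).mono
      (Icc_subset_Ici_self : Icc 0 R ⊆ Ici 0)
    have h := intervalIntegral.continuousOn_primitive_interval_left (μ := volume) (a := 0) (b := R)
      (by rw [uIcc_of_le hR.le]; exact hc.integrableOn_Icc)
    rw [uIcc_of_le hR.le] at h
    exact (h 0 ⟨le_rfl, hR.le⟩).mono_left
      (nhdsWithin_le_of_mem (Icc_mem_nhdsGT hR))
  have arc : Tendsto (fun ε : ℝ => ∫ θ in θ₁..θ₂,
      F (ε * Complex.exp (θ * Complex.I)) * (ε * Complex.exp (θ * Complex.I))) (𝓝[>] 0)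
      (𝓝 0) := by
    have hF0 : ContinuousAt F 0 := by
      have := (hF 0 le_rfl θ₁ ⟨le_rfl, hθ⟩).continuousAt
      simpa using this
    obtain ⟨δ, hδ, hball⟩ := Metric.eventually_nhds_iff.1
      (hF0.norm.eventually_lt_const (lt_add_one ‖F 0‖))
    refine squeeze_zero_norm' (a := fun ε : ℝ => (‖F 0‖ + 1) * ε * |θ₂ - θ₁|) ?_ ?_
    · filter_upwards [Ioo_mem_nhdsGT hδ] with ε hε
      refine intervalIntegral.norm_integral_le_of_norm_le_const fun θ _ => ?_
      have hn : ‖(ε : ℂ) * Complex.exp (θ * Complex.I)‖ = ε := by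
        rw [norm_mul, Complex.norm_exp_ofReal_mul_I, mul_one, Complex.norm_real,
          Real.norm_of_nonneg hε.1.le]
      rw [norm_mul, hn]
      refine mul_le_mul_of_nonneg_right (hball ?_).le hε.1.le
      rw [dist_zero_right, hn]
      exact hε.2
    · have : Continuous (fun ε : ℝ => (‖F 0‖ + 1) * ε * |θ₂ - θ₁|) := by fun_prop
      have h := (this.tendsto 0).mono_left (nhdsWithin_le_nhds (s := Ioi 0))
      simpa using h
  have total := (((lim θ₁ ⟨le_rfl, hθ⟩).sub (lim θ₂ ⟨hθ, le_rfl⟩)).add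
    (tendsto_const_nhds (x := Complex.I * (∫ θ in θ₁..θ₂,
        F (R * Complex.exp (θ * Complex.I)) * (R * Complex.exp (θ * Complex.I)))))).sub
    (arc.const_mul Complex.I)
  rw [mul_zero, sub_zero] at total
  refine tendsto_nhds_unique total (tendsto_const_nhds.congr' ?_)
  filter_upwards [Ioo_mem_nhdsGT hR] with ε hε
  exact (annular_sector_cauchy hθ hε.1 hε.2.le hF).symm

/-- Rotation of a ray of integration in the upper half-plane, for an integrand `e^{izx} G(z)` with
`G(z) = O(1/|z|)`. -/
lemma tendsto_sub_of_rotate {G : ℂ → ℂ} {θ₁ θ₂ x C : ℝ} (hθ : θ₁ ≤ θ₂) (hx : 0 < x)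
    (hsin : ∀ θ ∈ Icc θ₁ θ₂, 0 ≤ Real.sin θ) (hsin' : ∀ θ ∈ Ioo θ₁ θ₂, 0 < Real.sin θ)
    (hG : ∀ r : ℝ, 0 ≤ r → ∀ θ ∈ Icc θ₁ θ₂,
      DifferentiableAt ℂ G (r * Complex.exp (θ * Complex.I)))
    (hb : ∀ r : ℝ, 0 ≤ r → ∀ θ ∈ Icc θ₁ θ₂, ‖G (r * Complex.exp (θ * Complex.I))‖ * r ≤ C) :
    Tendsto (fun R : ℝ =>
      (∫ r in (0 : ℝ)..R, Complex.exp (Complex.I * (r * Complex.exp (θ₁ * Complex.I)) * x) *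
        G (r * Complex.exp (θ₁ * Complex.I)) * Complex.exp (θ₁ * Complex.I)) -
      ∫ r in (0 : ℝ)..R, Complex.exp (Complex.I * (r * Complex.exp (θ₂ * Complex.I)) * x) *
        G (r * Complex.exp (θ₂ * Complex.I)) * Complex.exp (θ₂ * Complex.I)) atTop (𝓝 0) := by
  have hC : 0 ≤ C := by simpa using hb 0 le_rfl θ₁ ⟨le_rfl, hθ⟩
  have hd : ∀ r : ℝ, 0 ≤ r → ∀ θ ∈ Icc θ₁ θ₂,
      DifferentiableAt ℂ (fun z => Complex.exp (Complex.I * z * x) * G z)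
        (r * Complex.exp (θ * Complex.I)) := fun r hr θ hθm =>
    DifferentiableAt.mul (by fun_prop) (hG r hr θ hθm)
  have hexp : ∀ R θ : ℝ, ‖Complex.exp (Complex.I * (R * Complex.exp (θ * Complex.I)) * x)‖ =
      Real.exp (-(x * Real.sin θ) * R) := by
    intro R θ
    rw [Complex.norm_exp]
    congr 1
    simp only [Complex.mul_re, Complex.mul_im, Complex.I_re, Complex.I_im, Complex.ofReal_re,
      Complex.ofReal_im, Complex.exp_ofReal_mul_I_re, Complex.exp_ofReal_mul_I_im]
    ring
  have bd : ∀ R : ℝ, 0 ≤ R → ∀ θ ∈ Icc θ₁ θ₂,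
      ‖Complex.exp (Complex.I * (R * Complex.exp (θ * Complex.I)) * x) *
        G (R * Complex.exp (θ * Complex.I)) * (R * Complex.exp (θ * Complex.I))‖ ≤
      Real.exp (-(x * Real.sin θ) * R) * C := by
    intro R hR θ hθm
    rw [norm_mul, norm_mul, hexp, norm_mul, Complex.norm_exp_ofReal_mul_I, mul_one,
      Complex.norm_real, Real.norm_of_nonneg hR, mul_assoc]
    exact mul_le_mul_of_nonneg_left (hb R hR θ hθm) (Real.exp_pos _).le
  -- Jordan's lemma by dominated convergence: the integrand on the arc is bounded by `C` and tends
  -- to `0` wherever `sin θ > 0`.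
  have arc : Tendsto (fun R : ℝ => ∫ θ in θ₁..θ₂,
      Complex.exp (Complex.I * (R * Complex.exp (θ * Complex.I)) * x) *
        G (R * Complex.exp (θ * Complex.I)) * (R * Complex.exp (θ * Complex.I))) atTop
      (𝓝 (∫ θ in θ₁..θ₂, (0 : ℂ))) := by
    refine intervalIntegral.tendsto_integral_filter_of_dominated_convergence (fun _ => C) ?_ ?_
      intervalIntegrable_const ?_
    · filter_upwards [eventually_ge_atTop 0] with R hR
      refine ContinuousOn.aestronglyMeasurable ?_ measurableSet_uIoc
      rw [uIoc_of_le hθ]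
      intro θ hθm
      refine ContinuousAt.continuousWithinAt (ContinuousAt.mul ?_ (by fun_prop))
      exact ContinuousAt.comp (f := fun θ : ℝ => (R : ℂ) * Complex.exp (θ * Complex.I))
        (hd R hR θ (Ioc_subset_Icc_self hθm)).continuousAt (by fun_prop)
    · filter_upwards [eventually_ge_atTop 0] with R hR
      refine Eventually.of_forall fun θ hθm => ?_
      rw [uIoc_of_le hθ] at hθm
      have hθm' := Ioc_subset_Icc_self hθm
      refine (bd R hR θ hθm').trans (mul_le_of_le_one_left hC ?_)
      rw [Real.exp_le_one_iff]
      have := mul_nonneg (mul_nonneg hx.le (hsin θ hθm')) hR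
      linarith
    -- The sine may vanish at the endpoints. The half-open interval already omits `θ₁`, and `θ₂` is
    -- a null set.
    · have hne : ∀ᵐ θ : ℝ, θ ≠ θ₂ := by simp [ae_iff]
      filter_upwards [hne] with θ hne hθm
      rw [uIoc_of_le hθ] at hθm
      have hs := hsin' θ ⟨hθm.1, lt_of_le_of_ne hθm.2 hne⟩
      refine squeeze_zero_norm' (a := fun R : ℝ => Real.exp (-(x * Real.sin θ) * R) * C) ?_ ?_
      · filter_upwards [eventually_ge_atTop 0] with R hR
        exact bd R hR θ (Ioc_subset_Icc_self hθm)
      · have h1 : Tendsto (fun R : ℝ => Real.exp (-(x * Real.sin θ) * R)) atTop (𝓝 0) :=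
          Real.tendsto_exp_atBot.comp
            (tendsto_id.const_mul_atTop_of_neg (by have := mul_pos hx hs; linarith))
        simpa using h1.mul_const C
  have h0 := arc.const_mul (-Complex.I)
  rw [intervalIntegral.integral_zero, mul_zero] at h0
  refine h0.congr' ?_
  filter_upwards [eventually_gt_atTop 0] with R hR
  linear_combination -sector_cauchy hθ hR hd

/-- In polar form the second condition of `sector` follows from `sin² θ ≤ 3/4`. -/
lemma polar_mem_sector {r θ : ℝ} (hr : 0 ≤ r)
    (hθ : θ ∈ Icc 0 (Real.pi / 3) ∨ θ ∈ Icc (2 * Real.pi / 3) Real.pi) :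
    (r : ℂ) * Complex.exp (θ * Complex.I) ∈ sector := by
  have hpi := Real.pi_pos
  have hs0 : 0 ≤ Real.sin θ := by
    rcases hθ with h | h
    · exact Real.sin_nonneg_of_nonneg_of_le_pi h.1 (by linarith [h.2])
    · exact Real.sin_nonneg_of_nonneg_of_le_pi (by linarith [h.1]) h.2
  have hs1 : Real.sin θ ≤ Real.sqrt 3 / 2 := by
    rw [← Real.sin_pi_div_three]
    rcases hθ with h | h
    · exact Real.sin_le_sin_of_le_of_le_pi_div_two (by linarith [h.1]) (by linarith) h.2
    · rw [← Real.sin_pi_sub θ]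
      exact Real.sin_le_sin_of_le_of_le_pi_div_two (by linarith [h.2]) (by linarith)
        (by linarith [h.1])
  have h3 : Real.sqrt 3 ^ 2 = 3 := Real.sq_sqrt (by norm_num)
  have h4 : Real.sin θ ^ 2 ≤ 3 / 4 := by
    calc Real.sin θ ^ 2 ≤ (Real.sqrt 3 / 2) ^ 2 := by gcongr
      _ = 3 / 4 := by rw [div_pow, h3]; norm_num
  constructor
  · rw [Complex.im_ofReal_mul, Complex.exp_ofReal_mul_I_im]
    positivity
  · rw [Complex.im_ofReal_mul, Complex.exp_ofReal_mul_I_im, Complex.re_ofReal_mul,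
      Complex.exp_ofReal_mul_I_re]
    have h5 := Real.sin_sq_add_cos_sq θ
    rw [mul_pow, mul_pow]
    nlinarith [mul_nonneg (sq_nonneg r) (sub_nonneg.2 h4)]

/-- The one-sided improper integrals over the two half-lines combine to an integral over `ℝ`. -/
lemma tendsto_integral_line {F : ℝ → ℂ} (hF : Continuous F) {I J : ℂ}
    (hI : Tendsto (fun R : ℝ => ∫ r in (0 : ℝ)..R, F r) atTop (𝓝 I))
    (hJ : Tendsto (fun R : ℝ => ∫ r in (0 : ℝ)..R, F (-r)) atTop (𝓝 J)) :
    Tendsto (fun p : ℝ × ℝ => ∫ s in p.1..p.2, F s) (atBot ×ˢ atTop) (𝓝 (J + I)) := by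
  have e : (fun p : ℝ × ℝ => ∫ s in p.1..p.2, F s) =
      fun p : ℝ × ℝ => (∫ r in (0 : ℝ)..(-p.1), F (-r)) + ∫ r in (0 : ℝ)..p.2, F r := by
    funext p
    rw [intervalIntegral.integral_comp_neg, neg_neg, neg_zero,
      intervalIntegral.integral_add_adjacent_intervals] <;> exact hF.intervalIntegrable _ _
  rw [e]
  exact (hJ.comp (tendsto_neg_atBot_atTop.comp tendsto_fst)).add (hI.comp tendsto_snd)

/-- Deformation of the real line into `Γ`. -/
lemma tendsto_line_of_sector {G : ℂ → ℂ} {x C : ℝ} (hx : 0 < x)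
    (hG : ∀ z ∈ sector, DifferentiableAt ℂ G z) (hb : ∀ z ∈ sector, ‖G z‖ * (1 + ‖z‖) ≤ C) :
    Tendsto (fun p : ℝ × ℝ => ∫ s in p.1..p.2, Complex.exp (Complex.I * s * x) * G s)
      (atBot ×ˢ atTop)
      (𝓝 (rayIntegral rayR (fun z => Complex.exp (Complex.I * z * x) * G z) -
        rayIntegral rayL (fun z => Complex.exp (Complex.I * z * x) * G z))) := by
  have hpi := Real.pi_pos
  have hRD : rayR ∈ ({rayR, rayL} : Set ℂ) := Or.inl rfl
  have hLD : rayL ∈ ({rayR, rayL} : Set ℂ) := Or.inr rfl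
  have eR : Complex.exp ((Real.pi / 3 : ℝ) * Complex.I) = rayR := by
    rw [rayR]; congr 1; push_cast; ring
  have eL : Complex.exp ((2 * Real.pi / 3 : ℝ) * Complex.I) = rayL := by
    rw [rayL]; congr 1; push_cast; ring
  have hb' : ∀ z ∈ sector, ‖G z‖ * ‖z‖ ≤ C := fun z hz =>
    (mul_le_mul_of_nonneg_left (by linarith) (norm_nonneg _)).trans (hb z hz)
  have hC : 0 ≤ C := by
    have := hb 0 (by simpa using ofReal_mem_sector 0)
    exact le_trans (by positivity) this
  have pb : PolyBounded (cone {rayR, rayL}) (univ : Set Unit) 0 (fun z _ => G z) := by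
    refine ⟨?_, C, hC, fun z hz _ _ => ?_⟩
    · intro q hq
      exact (ContinuousAt.comp (f := fun q : ℂ × Unit => q.1)
        (hG _ (cone_gamma_subset_sector hq.1)).continuousAt (by fun_prop)).continuousWithinAt
    · rw [zpow_zero, mul_one]
      refine le_trans ?_ (hb z (cone_gamma_subset_sector hz))
      exact le_mul_of_one_le_right (norm_nonneg _) (by linarith [norm_nonneg z])
  have iR := pb.integrableOn_ray hRD norm_rayR (by rw [rayR_im]; positivity)
    (weightIntegrable_rayR 0) hx (mem_univ ())
  have iL := pb.integrableOn_ray hLD norm_rayL (by rw [rayL_im]; positivity)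
    (weightIntegrable_rayL 0) hx (mem_univ ())
  have tR := intervalIntegral_tendsto_integral_Ioi 0 iR tendsto_id
  have tL := intervalIntegral_tendsto_integral_Ioi 0 iL tendsto_id
  have hnorm : ∀ r θ : ℝ, 0 ≤ r → ‖(r : ℂ) * Complex.exp (θ * Complex.I)‖ = r := by
    intro r θ hr
    rw [norm_mul, Complex.norm_exp_ofReal_mul_I, mul_one, Complex.norm_real,
      Real.norm_of_nonneg hr]
  have rotR := tendsto_sub_of_rotate (G := G) (θ₁ := 0) (θ₂ := Real.pi / 3) (C := C)
    (by positivity) hx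
    (fun θ hθ => Real.sin_nonneg_of_nonneg_of_le_pi hθ.1 (by linarith [hθ.2]))
    (fun θ hθ => Real.sin_pos_of_pos_of_lt_pi hθ.1 (by linarith [hθ.2]))
    (fun r hr θ hθ => hG _ (polar_mem_sector hr (Or.inl hθ)))
    (fun r hr θ hθ => by
      have := hb' _ (polar_mem_sector hr (Or.inl hθ))
      rwa [hnorm r θ hr] at this)
  have rotL := tendsto_sub_of_rotate (G := G) (θ₁ := 2 * Real.pi / 3) (θ₂ := Real.pi) (C := C)
    (by linarith) hx
    (fun θ hθ => Real.sin_nonneg_of_nonneg_of_le_pi (by linarith [hθ.1]) hθ.2)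
    (fun θ hθ => Real.sin_pos_of_pos_of_lt_pi (by linarith [hθ.1]) hθ.2)
    (fun r hr θ hθ => hG _ (polar_mem_sector hr (Or.inr hθ)))
    (fun r hr θ hθ => by
      have := hb' _ (polar_mem_sector hr (Or.inr hθ))
      rwa [hnorm r θ hr] at this)
  simp only [eR, eL, Complex.exp_pi_mul_I, Complex.ofReal_zero, zero_mul, Complex.exp_zero,
    mul_one] at rotR rotL
  have hcont : Continuous (fun s : ℝ => Complex.exp (Complex.I * s * x) * G s) := by
    refine Continuous.mul (by fun_prop) (continuous_iff_continuousAt.2 fun s => ?_)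
    exact ContinuousAt.comp (f := fun s : ℝ => (s : ℂ)) (hG _ (ofReal_mem_sector s)).continuousAt
      (by fun_prop)
  have hI : Tendsto (fun R : ℝ => ∫ r in (0 : ℝ)..R, Complex.exp (Complex.I * r * x) * G r) atTop
      (𝓝 (rayIntegral rayR (fun z => Complex.exp (Complex.I * z * x) * G z))) := by
    have := rotR.add tR
    rw [zero_add] at this
    refine this.congr fun R => ?_
    simp
  have hJ : Tendsto (fun R : ℝ => ∫ r in (0 : ℝ)..R,
      Complex.exp (Complex.I * (-r : ℝ) * x) * G (-r : ℝ)) atTop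
      (𝓝 (-rayIntegral rayL (fun z => Complex.exp (Complex.I * z * x) * G z))) := by
    have := rotL.sub tL
    rw [zero_sub] at this
    refine this.congr fun R => ?_
    simp
  have := tendsto_integral_line hcont hI hJ
  rwa [neg_add_eq_sub] at this

end

section

/-! ### The evolution of `z`-independent data is entire and bounded on the sector -/

lemma differentiable_laplace {c : ℝ → ℂ} {t : ℝ} (ht : 0 ≤ t) (hc : ContinuousOn c (Icc 0 t)) :
    Differentiable ℂ (fun w : ℂ => ∫ τ in (0 : ℝ)..t, Complex.exp (w * τ) * c τ) := by
  intro w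
  obtain ⟨B, hB⟩ := isCompact_Icc.exists_bound_of_continuousOn hc
  have meas : ∀ {φ : ℝ → ℂ}, Continuous φ →
      AEStronglyMeasurable (fun τ => φ τ * c τ) (volume.restrict (uIoc 0 t)) := by
    intro φ hφ
    refine ContinuousOn.aestronglyMeasurable ?_ measurableSet_uIoc
    rw [uIoc_of_le ht]
    exact hφ.continuousOn.mul (hc.mono Ioc_subset_Icc_self)
  have key := intervalIntegral.hasDerivAt_integral_of_dominated_loc_of_deriv_le
    (μ := volume) (𝕜 := ℂ) (x₀ := w) (a := 0) (b := t)
    (F := fun w τ => Complex.exp (w * τ) * c τ)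
    (F' := fun w τ => (Complex.exp (w * τ) * τ) * c τ)
    (bound := fun _ => Real.exp ((‖w‖ + 1) * t) * t * B) (s := Metric.ball w 1)
    (Metric.ball_mem_nhds w one_pos)
    (Eventually.of_forall fun w => meas (by fun_prop)) ?_ (meas (by fun_prop)) ?_
    intervalIntegrable_const ?_
  · exact key.2.differentiableAt
  · refine ContinuousOn.intervalIntegrable ?_
    rw [uIcc_of_le ht]
    exact ContinuousOn.mul (by fun_prop) hc
  · refine Eventually.of_forall fun τ hτ v hv => ?_
    rw [uIoc_of_le ht] at hτ
    have hv' : ‖v‖ ≤ ‖w‖ + 1 := by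
      have h1 : ‖v - w‖ < 1 := by simpa [dist_eq_norm] using hv
      have h2 := norm_le_norm_add_norm_sub' v w
      linarith
    rw [norm_mul, norm_mul, Complex.norm_real, Real.norm_of_nonneg hτ.1.le]
    have h3 : ‖Complex.exp (v * τ)‖ ≤ Real.exp ((‖w‖ + 1) * t) := by
      refine (Complex.norm_exp_le_exp_norm _).trans (Real.exp_le_exp.2 ?_)
      rw [norm_mul, Complex.norm_real, Real.norm_of_nonneg hτ.1.le]
      exact mul_le_mul hv' hτ.2 hτ.1.le (by positivity)
    exact mul_le_mul (mul_le_mul h3 hτ.2 hτ.1.le (by positivity))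
      (hB τ (Ioc_subset_Icc_self hτ)) (norm_nonneg _) (by positivity)
  · refine Eventually.of_forall fun τ _ v _ => ?_
    exact (((hasDerivAt_id v).mul_const (τ : ℂ)).cexp.congr_deriv (by simp)).mul_const _

lemma differentiable_evolve_param {c : ℝ → ℂ} {t : ℝ} (ht : 0 ≤ t)
    (hc : ContinuousOn c (Icc 0 t)) (κ μ : ℂ) :
    Differentiable ℂ (fun z => evolve κ μ (fun _ τ => c τ) z t) := by
  have hdisp : Differentiable ℂ disp := fun z => (hasDerivAt_disp z).differentiableAt
  simp only [evolve_eq]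
  refine Differentiable.mul (by fun_prop) (Differentiable.const_add _ (Differentiable.const_mul
    ?_ _))
  exact (differentiable_laplace ht hc).comp hdisp

/-- Both `Re ω ≥ 0` and the time lag `t - τ ≥ 0` enter, so every exponential has modulus at most
`1`. Independence of `c` from `z` is essential: a half-line transform is not controlled for `Im z >
0`. -/
lemma exists_bound_evolve_param {c : ℝ → ℂ} {t : ℝ} (ht : 0 ≤ t)
    (hc : ContinuousOn c (Icc 0 t)) (κ μ : ℂ) :
    ∃ C : ℝ, ∀ z ∈ sector, ‖evolve κ μ (fun _ τ => c τ) z t‖ ≤ C := by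
  obtain ⟨B, hB⟩ := isCompact_Icc.exists_bound_of_continuousOn hc
  have hexp : ∀ z ∈ sector, ∀ s : ℝ, 0 ≤ s → ‖Complex.exp (-disp z * s)‖ ≤ 1 := by
    intro z hz s hs
    rw [Complex.norm_exp, Real.exp_le_one_iff, Complex.re_mul_ofReal, Complex.neg_re]
    have := mul_nonneg (disp_re_nonneg hz) hs
    linarith
  have hm : ∀ z ∈ sector, ∀ s : ℝ, 0 ≤ s → ∀ τ ∈ Icc 0 t,
      ‖Complex.exp (-disp z * s) * c τ‖ ≤ B := by
    intro z hz s hs τ hτ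
    rw [norm_mul]
    exact (mul_le_of_le_one_left (norm_nonneg _) (hexp z hz s hs)).trans (hB τ hτ)
  refine ⟨‖κ‖ * B + ‖μ‖ * (B * |t - 0|), fun z hz => ?_⟩
  refine norm_add_le_of_le ?_ ?_ <;> rw [norm_mul] <;>
    refine mul_le_mul_of_nonneg_left ?_ (norm_nonneg _)
  · exact hm z hz t ht 0 ⟨le_rfl, ht⟩
  · refine intervalIntegral.norm_integral_le_of_norm_le_const fun τ hτ => ?_
    rw [uIoc_of_le ht] at hτ
    exact hm z hz (t - τ) (by linarith [hτ.2]) τ (Ioc_subset_Icc_self hτ)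

/-! ### Families of mixed derivatives on the closed quarter-plane -/

/-- `φ k m` plays the role of `∂_y^k ∂_τ^m φ₀₀`, rapidly decreasing in `y ≥ 0`. -/
structure IsDataFamily (φ : ℕ → ℕ → ℝ → ℝ → ℂ) : Prop where
  rapid : ∀ k m T, RapidOn (Icc 0 T) (φ k m)
  deriv_space : ∀ k m y τ, 0 < y → 0 ≤ τ → HasDerivAt (fun y => φ k m y τ) (φ (k + 1) m y τ) y
  deriv_time : ∀ k m y τ, 0 ≤ y → 0 < τ → HasDerivAt (fun τ => φ k m y τ) (φ k (m + 1) y τ) τ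

/-- Closure under `u ↦ u + u'` allows the integration by parts in the transform to be iterated. -/
lemma IsDataFamily.one_add_deriv {φ : ℕ → ℕ → ℝ → ℝ → ℂ} (hφ : IsDataFamily φ) :
    IsDataFamily (fun k m y τ => φ k m y τ + φ (k + 1) m y τ) where
  rapid k m T := (hφ.rapid k m T).add (hφ.rapid (k + 1) m T)
  deriv_space k m y τ hy hτ := (hφ.deriv_space k m y τ hy hτ).add (hφ.deriv_space _ m y τ hy hτ)
  deriv_time k m y τ hy hτ := (hφ.deriv_time k m y τ hy hτ).add (hφ.deriv_time _ m y τ hy hτ)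

lemma IsDataFamily.continuousOn_time {φ : ℕ → ℕ → ℝ → ℝ → ℂ} (hφ : IsDataFamily φ) (k m : ℕ)
    {y : ℝ} (hy : 0 ≤ y) : ContinuousOn (fun τ => φ k m y τ) (Ici 0) := by
  intro t ht
  have h1 : ContinuousOn (fun τ => φ k m y τ) (Icc 0 (t + 1)) :=
    (hφ.rapid k m (t + 1)).cont.comp (f := fun t : ℝ => (y, t)) (by fun_prop) fun s hs => ⟨hy, hs⟩
  refine (h1 t ⟨ht, by linarith⟩).mono_of_mem_nhdsWithin ?_
  filter_upwards [self_mem_nhdsWithin, nhdsWithin_le_nhds (gt_mem_nhds (lt_add_one t))]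
    with s hs hs' using ⟨hs, le_of_lt hs'⟩

/-- The closed quarter-plane. -/
def quarter : Set (ℝ × ℝ) := Ici 0 ×ˢ Ici 0

/-- The derivative within the closed quarter-plane in the direction `v`. -/
noncomputable def dirDeriv (v : ℝ × ℝ) (F : ℝ × ℝ → ℂ) (p : ℝ × ℝ) : ℂ :=
  fderivWithin ℝ F quarter p v

lemma uniqueDiffOn_quarter : UniqueDiffOn ℝ quarter :=
  (uniqueDiffOn_Ici 0).prod (uniqueDiffOn_Ici 0)

lemma contDiffOn_dirDeriv {F : ℝ × ℝ → ℂ} (hF : ContDiffOn ℝ ∞ F quarter) (v : ℝ × ℝ) :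
    ContDiffOn ℝ ∞ (dirDeriv v F) quarter :=
  (hF.fderivWithin uniqueDiffOn_quarter (by simp)).clm_apply contDiffOn_const

lemma contDiffOn_dirDeriv_iterate {F : ℝ × ℝ → ℂ} (hF : ContDiffOn ℝ ∞ F quarter) (v : ℝ × ℝ)
    (k : ℕ) : ContDiffOn ℝ ∞ ((dirDeriv v)^[k] F) quarter := by
  induction k with
  | zero => exact hF
  | succ k ih =>
    rw [Function.iterate_succ_apply']
    exact contDiffOn_dirDeriv ih v

lemma dirDeriv_congr {F G : ℝ × ℝ → ℂ} (h : EqOn F G quarter) (v : ℝ × ℝ) :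
    EqOn (dirDeriv v F) (dirDeriv v G) quarter := fun p hp => by
  rw [dirDeriv, dirDeriv, fderivWithin_congr h (h hp)]

/-- Symmetry of the second derivative holds up to the boundary, because the quarter-plane lies in
the closure of its interior. -/
lemma dirDeriv_comm {F : ℝ × ℝ → ℂ} (hF : ContDiffOn ℝ ∞ F quarter) (v w : ℝ × ℝ) :
    EqOn (dirDeriv v (dirDeriv w F)) (dirDeriv w (dirDeriv v F)) quarter := by
  intro p hp
  have hsymm : IsSymmSndFDerivWithinAt ℝ F quarter p := by
    refine (hF p hp).isSymmSndFDerivWithinAt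
      (by simpa using WithTop.coe_le_coe.2 (le_top : (2 : ℕ∞) ≤ ⊤))
      uniqueDiffOn_quarter ?_ hp
    rw [quarter, interior_prod_eq, closure_prod_eq, interior_Ici, closure_Ioi]
    exact hp
  have hd : DifferentiableWithinAt ℝ (fderivWithin ℝ F quarter) quarter p :=
    ((hF.fderivWithin uniqueDiffOn_quarter (m := ∞) (by simp)).differentiableOn (by simp)) p hp
  have e : ∀ v w : ℝ × ℝ, dirDeriv v (dirDeriv w F) p =
      fderivWithin ℝ (fderivWithin ℝ F quarter) quarter p v w := by
    intro v w
    have := (hd.hasFDerivWithinAt.clm_apply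
      (hasFDerivWithinAt_const w p quarter)).fderivWithin (uniqueDiffOn_quarter p hp)
    rw [dirDeriv]
    unfold dirDeriv
    rw [this]
    simp
  rw [e, e]
  exact hsymm v w

lemma dirDeriv_iterate_comm {F : ℝ × ℝ → ℂ} (hF : ContDiffOn ℝ ∞ F quarter) (v w : ℝ × ℝ)
    (k : ℕ) : EqOn (dirDeriv v ((dirDeriv w)^[k] F)) ((dirDeriv w)^[k] (dirDeriv v F)) quarter := by
  induction k with
  | zero => exact fun _ _ => rfl
  | succ k ih =>
    intro p hp
    rw [Function.iterate_succ_apply', Function.iterate_succ_apply',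
      dirDeriv_comm (contDiffOn_dirDeriv_iterate hF w k) v w hp]
    exact dirDeriv_congr ih w hp

lemma hasDerivWithinAt_space {F : ℝ × ℝ → ℂ} (hF : ContDiffOn ℝ ∞ F quarter) {y τ : ℝ}
    (hy : 0 ≤ y) (hτ : 0 ≤ τ) :
    HasDerivWithinAt (fun y => F (y, τ)) (dirDeriv (1, 0) F (y, τ)) (Ici 0) y := by
  have h1 := ((hF.differentiableOn (by simp)) (y, τ) ⟨hy, hτ⟩).hasFDerivWithinAt
  exact h1.comp_hasDerivWithinAt y ((hasDerivWithinAt_id y _).prodMk (hasDerivWithinAt_const y _ τ))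
    (show MapsTo (fun y : ℝ => (y, τ)) (Ici 0) quarter from fun _ hs => ⟨hs, hτ⟩)

lemma hasDerivWithinAt_time {F : ℝ × ℝ → ℂ} (hF : ContDiffOn ℝ ∞ F quarter) {y τ : ℝ}
    (hy : 0 ≤ y) (hτ : 0 ≤ τ) :
    HasDerivWithinAt (fun τ => F (y, τ)) (dirDeriv (0, 1) F (y, τ)) (Ici 0) τ := by
  have h1 := ((hF.differentiableOn (by simp)) (y, τ) ⟨hy, hτ⟩).hasFDerivWithinAt
  exact h1.comp_hasDerivWithinAt τ ((hasDerivWithinAt_const τ _ y).prodMk (hasDerivWithinAt_id τ _))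
    (show MapsTo (fun τ : ℝ => (y, τ)) (Ici 0) quarter from fun _ hs => ⟨hy, hs⟩)

lemma iteratedDerivWithin_space {F : ℝ × ℝ → ℂ} (hF : ContDiffOn ℝ ∞ F quarter) (k : ℕ) {y τ : ℝ}
    (hy : 0 ≤ y) (hτ : 0 ≤ τ) :
    iteratedDerivWithin k (fun y => F (y, τ)) (Ici 0) y = (dirDeriv (1, 0))^[k] F (y, τ) := by
  induction k generalizing y with
  | zero => simp
  | succ k ih =>
    have e : EqOn (iteratedDerivWithin k (fun y => F (y, τ)) (Ici 0))
      (fun y => (dirDeriv (1, 0))^[k] F (y, τ)) (Ici 0) := fun z hz => ih hz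
    rw [iteratedDerivWithin_succ, derivWithin_congr e (e hy),
      Function.iterate_succ_apply']
    exact (hasDerivWithinAt_space (contDiffOn_dirDeriv_iterate hF _ k) hy hτ).derivWithin
      (uniqueDiffOn_Ici 0 y hy)

lemma iteratedDerivWithin_time {F : ℝ × ℝ → ℂ} (hF : ContDiffOn ℝ ∞ F quarter) (m : ℕ) {y τ : ℝ}
    (hy : 0 ≤ y) (hτ : 0 ≤ τ) :
    iteratedDerivWithin m (fun τ => F (y, τ)) (Ici 0) τ = (dirDeriv (0, 1))^[m] F (y, τ) := by
  induction m generalizing τ with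
  | zero => simp
  | succ m ih =>
    have e : EqOn (iteratedDerivWithin m (fun τ => F (y, τ)) (Ici 0))
      (fun τ => (dirDeriv (0, 1))^[m] F (y, τ)) (Ici 0) := fun z hz => ih hz
    rw [iteratedDerivWithin_succ, derivWithin_congr e (e hτ),
      Function.iterate_succ_apply']
    exact (hasDerivWithinAt_time (contDiffOn_dirDeriv_iterate hF _ m) hy hτ).derivWithin
      (uniqueDiffOn_Ici 0 τ hτ)

/-- The mixed derivatives of a Schwartz forcing term form a data family. -/
lemma IsSchwartzForcing.exists_dataFamily {f : ℝ → ℝ → ℂ} (hf : IsSchwartzForcing f) :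
    ∃ φ, IsDataFamily φ ∧ φ 0 0 = f := by
  set F : ℝ × ℝ → ℂ := fun p => f p.1 p.2
  have hF : ContDiffOn ℝ ∞ F quarter := hf.smooth
  have hs : ∀ k m, ContDiffOn ℝ ∞ ((dirDeriv (1, 0))^[k] ((dirDeriv (0, 1))^[m] F)) quarter :=
    fun k m => contDiffOn_dirDeriv_iterate (contDiffOn_dirDeriv_iterate hF _ m) _ k
  refine ⟨fun k m y τ => (dirDeriv (1, 0))^[k] ((dirDeriv (0, 1))^[m] F) (y, τ),
    ⟨fun k m T => ⟨?_, fun l => ?_⟩, fun k m y τ hy hτ => ?_, fun k m y τ hy hτ => ?_⟩, rfl⟩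
  · exact (hs k m).continuousOn.mono (prod_mono le_rfl Icc_subset_Ici_self)
  · obtain ⟨C, hC⟩ := hf.decay T k m l
    refine ⟨C, fun y hy τ hτ => ?_⟩
    have e : EqOn (fun y => iteratedDerivWithin m (fun s => f y s) (Ici 0) τ)
      (fun y => (dirDeriv (0, 1))^[m] F (y, τ)) (Ici 0) := fun z hz =>
      iteratedDerivWithin_time hF m hz hτ.1
    rw [← iteratedDerivWithin_space (contDiffOn_dirDeriv_iterate hF _ m) k hy hτ.1,
      ← iteratedDerivWithin_congr e hy]
    exact hC y τ hy hτ.1 hτ.2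
  · rw [Function.iterate_succ_apply']
    exact (hasDerivWithinAt_space (hs k m) hy.le hτ).hasDerivAt (Ici_mem_nhds hy)
  · have h1 := (hasDerivWithinAt_time (hs k m) hy hτ.le).hasDerivAt (Ici_mem_nhds hτ)
    refine h1.congr_deriv ?_
    -- The new `τ`-derivative is moved inside the `y`-derivatives, to match the order in which the
    -- family is defined.
    rw [dirDeriv_iterate_comm (contDiffOn_dirDeriv_iterate hF _ m) _ _ k
      (show (y, τ) ∈ quarter from ⟨hy, hτ.le⟩),
      Function.iterate_succ_apply']

/-- Schwartz initial data, regarded as time-independent forcing. -/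
lemma IsSchwartzHalfLine.isSchwartzForcing {u : ℝ → ℂ} (hu : IsSchwartzHalfLine u) :
    IsSchwartzForcing (fun y _ => u y) where
  smooth := hu.smooth.comp contDiffOn_fst fun _ hp => hp.1
  decay T k m l := by
    rcases m with _ | m
    · obtain ⟨C, hC⟩ := hu.decay k l
      exact ⟨C, fun x t hx _ _ => by simpa using hC x hx⟩
    · refine ⟨0, fun x t hx _ _ => ?_⟩
      simp only [iteratedDerivWithin_const]
      simp

/-- The one-sided derivatives of a smooth function on `[0, ∞)`. -/
lemma ContDiffOn.hasDerivAt_iteratedDerivWithin_Ici {g : ℝ → ℂ} (hg : ContDiffOn ℝ ∞ g (Ici 0))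
    (m : ℕ) {t : ℝ} (ht : 0 < t) :
    HasDerivAt (iteratedDerivWithin m g (Ici 0)) (iteratedDerivWithin (m + 1) g (Ici 0) t) t := by
  have h := (hg.differentiableOn_iteratedDerivWithin (m := m)
    (by exact_mod_cast WithTop.coe_lt_top _) (uniqueDiffOn_Ici 0)) t ht.le
  rw [iteratedDerivWithin_succ]
  exact h.hasDerivWithinAt.hasDerivAt (Ici_mem_nhds ht)

end

section

/-! ### Amplitudes on `ℝ` and on `Γ` -/

section

variable {n : ℕ} {p : ℤ} {F : ℂ → ℝ → ℂ}

lemma IsAmplitude.polyBounded {D : Set ℂ} (hF : IsAmplitude D n p F) (T : ℝ) :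
    PolyBounded (cone D) (Icc 0 T) p F := by
  obtain ⟨G, h0, -, h2⟩ := hF
  have := ((h2 0 T).congr fun z hz t ht => h0 z hz t ht.1).polyBounded
  simpa using this

lemma IsAmplitude.continuous_line (hF : IsAmplitude {1, -1} n p F) (x : ℝ) {t : ℝ} (ht : 0 ≤ t) :
    Continuous (fun s : ℝ => Complex.exp (Complex.I * s * x) * F s t) := by
  refine Continuous.mul (by fun_prop) ?_
  exact (hF.continuousOn t).comp_continuous (f := fun s : ℝ => ((s : ℂ), t)) (by fun_prop)
    fun s => ⟨mem_cone_line.2 ⟨s, rfl⟩, ht, le_rfl⟩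

lemma IsAmplitude.tendsto_line (hF : IsAmplitude {1, -1} n p F) (hp : p ≤ -2) {x t : ℝ}
    (hx : 0 < x) (ht : 0 ≤ t) :
    Tendsto (fun q : ℝ × ℝ => ∫ s in q.1..q.2, Complex.exp (Complex.I * s * x) * F s t)
      (atBot ×ˢ atTop)
      (𝓝 (rayIntegral 1 (fun z => Complex.exp (Complex.I * z * x) * F z t) -
        rayIntegral (-1) (fun z => Complex.exp (Complex.I * z * x) * F z t))) := by
  have i1 := (hF.polyBounded t).integrableOn_ray (Or.inl rfl) (by simp) (by simp)
    (weightIntegrable_of_im_eq_zero (by simp) hp) hx ⟨ht, le_rfl⟩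
  have i2 := (hF.polyBounded t).integrableOn_ray (Or.inr rfl) (by simp) (by simp)
    (weightIntegrable_of_im_eq_zero (by simp) hp) hx ⟨ht, le_rfl⟩
  have t1 := intervalIntegral_tendsto_integral_Ioi 0 i1 tendsto_id
  have t2 := (intervalIntegral_tendsto_integral_Ioi 0 i2 tendsto_id).neg
  have := tendsto_integral_line (hF.continuous_line x ht) (t1.congr fun R => ?_)
    (t2.congr fun R => ?_)
  · rw [neg_add_eq_sub] at this
    exact this
  · simp
  · simp

lemma isSymbol_inv_pow {D : Set ℂ} (hD : cone D ⊆ sector) (n j : ℕ) :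
    IsSymbol D (univ : Set ℝ) n (-(j : ℤ)) (fun z _ => ((1 + Complex.I * z)⁻¹) ^ j) :=
  ((IsSymbol.inv_one_add (by norm_num : (0 : ℝ) < 1 / 5)
    fun z hz => sector_lower_bound (hD hz)).pow j).mono (by lia)

lemma IsAmplitude.decaysUpTo_gamma {M : ℕ} (hF : IsAmplitude {rayR, rayL} M p F) :
    DecaysUpTo M (fun x t => gammaIntegral (fun z => Complex.exp (Complex.I * z * x) * F z t)) :=
  hF.decaysUpTo norm_rayR norm_rayL (by rw [rayR_im]; positivity) (by rw [rayL_im]; positivity)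
    le_rfl (weightIntegrable_rayR _) (weightIntegrable_rayL _)

lemma IsAmplitude.convergesOnGamma (hF : IsAmplitude {rayR, rayL} n p F) {x t : ℝ}
    (hx : 0 < x) (ht : 0 ≤ t) :
    ConvergesOnGamma (fun z => Complex.exp (Complex.I * z * x) * F z t) := by
  have main : ∀ d ∈ ({rayR, rayL} : Set ℂ), ‖d‖ = 1 → 0 ≤ d.im → WeightIntegrable d p →
      IntegrableOn (fun r : ℝ => Complex.exp (Complex.I * (r * d) * x) * F (r * d) t) (Ioi 0) := by
    intro d hd hd1 him hw
    have hd0 : d ≠ 0 := by rintro rfl; simp at hd1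
    have i := (hF.polyBounded t).integrableOn_ray hd hd1 him hw hx ⟨ht, le_rfl⟩
    have i4 : IntegrableOn (fun r : ℝ => Complex.exp (Complex.I * (r * d) * x) * F (r * d) t * d *
      d⁻¹) (Ioi 0) := i.mul_const d⁻¹
    refine i4.congr_fun (fun r _ => ?_) measurableSet_Ioi
    field_simp
  exact ⟨main _ (Or.inl rfl) norm_rayR (by rw [rayR_im]; positivity) (weightIntegrable_rayR _),
    main _ (Or.inr rfl) norm_rayL (by rw [rayL_im]; positivity) (weightIntegrable_rayL _)⟩

end

/-! ### The integrals over the real line -/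

variable {φ : ℕ → ℕ → ℝ → ℝ → ℂ} {κ μ : ℂ}

lemma IsDataFamily.isAmplitude_hat (hφ : IsDataFamily φ) {D : Set ℂ} {β : ℂ}
    (hD : ∀ z ∈ cone D, (β * z).im ≤ 0) (n : ℕ) :
    IsAmplitude D n 0 (fun z τ => hat (fun y => φ 0 0 y τ) (β * z)) :=
  IsAmplitude.hat (h := fun m => φ 0 m) (fun m T => hφ.rapid 0 m T)
    (fun m y τ hy hτ => hφ.deriv_time 0 m y τ hy hτ) hD

lemma IsDataFamily.isAmplitude_hat_line (hφ : IsDataFamily φ) (n : ℕ) :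
    IsAmplitude {1, -1} n 0 (fun z τ => hat (fun y => φ 0 0 y τ) z) := by
  refine (hφ.isAmplitude_hat (D := {1, -1}) (β := 1) (fun z hz => ?_) n).congr fun z _ τ _ => ?_
  · obtain ⟨s, rfl⟩ := mem_cone_line.1 hz
    simp
  · simp only [one_mul]

/-- This is where `deriv_time` is needed at `y = 0`. -/
lemma IsDataFamily.isAmplitude_trace (hφ : IsDataFamily φ) {D : Set ℂ} (n : ℕ) :
    IsAmplitude D n 0 (fun _ τ => φ 0 0 0 τ) :=
  IsAmplitude.param (c := fun m τ => φ 0 m 0 τ) (fun m => hφ.continuousOn_time 0 m le_rfl)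
    fun m t ht => hφ.deriv_time 0 m 0 t le_rfl ht

/-- One integration by parts in the transform splits off the contribution of the boundary value. -/
lemma IsDataFamily.evolve_hat_eq (hφ : IsDataFamily φ) (s : ℝ) {t : ℝ} (ht : 0 ≤ t) :
    evolve κ μ (fun z τ => hat (fun y => φ 0 0 y τ) z) s t =
      (1 + Complex.I * s)⁻¹ * (evolve κ μ (fun _ τ => φ 0 0 0 τ) s t +
        evolve κ μ (fun z τ => hat (fun y => φ 0 0 y τ + φ 1 0 y τ) z) s t) := by
  have hs : (s : ℂ) ∈ cone {1, -1} := mem_cone_line.2 ⟨s, rfl⟩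
  have hne := one_add_I_mul_ne_zero (ofReal_mem_sector s)
  rw [← evolve_add (A := fun _ τ => φ 0 0 0 τ)
      (B := fun z τ => hat (fun y => φ 0 0 y τ + φ 1 0 y τ) z) ht
      (hφ.continuousOn_time 0 0 le_rfl)
      ((hφ.one_add_deriv.isAmplitude_hat_line 0).continuousOn_time hs),
    ← evolve_mul_left (fun z => (1 + Complex.I * z)⁻¹)]
  refine evolve_congr ht fun τ hτ hτt => ?_
  rw [eq_inv_mul_iff_mul_eq₀ hne]
  exact (hφ.rapid 0 0 t).hat_eq (hφ.rapid 1 0 t) ⟨hτ, hτt⟩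
    (fun y hy => hφ.deriv_space 0 0 y τ hy hτ) (by simp)

/-- The contribution of the boundary value can be moved from `ℝ` to `Γ`. -/
lemma tendsto_line_trace {c : ℝ → ℂ} (j : ℕ) {x t : ℝ} (hx : 0 < x) (ht : 0 ≤ t)
    (hc : ContinuousOn c (Icc 0 t)) :
    Tendsto (fun q : ℝ × ℝ => ∫ s in q.1..q.2, Complex.exp (Complex.I * s * x) *
        (((1 + Complex.I * s)⁻¹) ^ (j + 1) * evolve κ μ (fun _ τ => c τ) s t)) (atBot ×ˢ atTop)
      (𝓝 (gammaIntegral (fun z => Complex.exp (Complex.I * z * x) *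
        (((1 + Complex.I * z)⁻¹) ^ (j + 1) * evolve κ μ (fun _ τ => c τ) z t)))) := by
  obtain ⟨C, hC⟩ := exists_bound_evolve_param ht hc κ μ
  -- Of the `j + 1` inverse factors, `j` are bounded by `5` each; the last absorbs the weight `1 +
  -- |z|`, again at the price of `5`. At least one such factor is needed for the `O(1/|z|)` of
  -- Jordan's lemma.
  refine tendsto_line_of_sector (G := fun z => ((1 + Complex.I * z)⁻¹) ^ (j + 1) *
    evolve κ μ (fun _ τ => c τ) z t) (C := 5 ^ (j + 1) * C) hx (fun z hz => ?_) fun z hz => ?_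
  · have hne := one_add_I_mul_ne_zero hz
    have h1 : DifferentiableAt ℂ (fun z : ℂ => 1 + Complex.I * z) z := by fun_prop
    exact ((h1.inv hne).pow _).mul (differentiable_evolve_param ht hc κ μ z)
  · have h1 := sector_lower_bound hz
    have hpos : 0 < ‖1 + Complex.I * z‖ := norm_pos_iff.2 (one_add_I_mul_ne_zero hz)
    have hz1 : 1 ≤ 1 + ‖z‖ := by linarith [norm_nonneg z]
    have h2 : ‖1 + Complex.I * z‖⁻¹ * (1 + ‖z‖) ≤ 5 := by
      rw [inv_mul_le_iff₀ hpos]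
      linarith
    have h3 : ‖1 + Complex.I * z‖⁻¹ ≤ 5 :=
      (le_mul_of_one_le_right (by positivity) hz1).trans h2
    have hC0 : 0 ≤ C := (norm_nonneg _).trans (hC z hz)
    calc ‖((1 + Complex.I * z)⁻¹) ^ (j + 1) * evolve κ μ (fun _ τ => c τ) z t‖ * (1 + ‖z‖)
        = ‖1 + Complex.I * z‖⁻¹ ^ j * (‖1 + Complex.I * z‖⁻¹ * (1 + ‖z‖)) *
            ‖evolve κ μ (fun _ τ => c τ) z t‖ := by
          rw [norm_mul, norm_pow, norm_inv, pow_succ]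
          ring
      _ ≤ 5 ^ j * 5 * C := by
          gcongr
          exact hC z hz
      _ = 5 ^ (j + 1) * C := by rw [pow_succ]

/-- Here `j` counts the integrations by parts already made and `d` those still to come. At order
`-(6M + 6)` the loss `6M + 4` of `IsAmplitude.decaysUpTo` leaves `-2`, which is integrable on `ℝ`.
-/
lemma IsDataFamily.exists_line_decay (hφ : IsDataFamily φ) (κ μ : ℂ) (M d j : ℕ)
    (hj : 6 * M + 6 ≤ j + d) :
    ∃ V : ℝ → ℝ → ℂ, DecaysUpTo M V ∧ ∀ x t : ℝ, 0 < x → 0 < t →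
      Tendsto (fun q : ℝ × ℝ => ∫ s in q.1..q.2, Complex.exp (Complex.I * s * x) *
        (((1 + Complex.I * s)⁻¹) ^ j * evolve κ μ (fun z τ => hat (fun y => φ 0 0 y τ) z) s t))
        (atBot ×ˢ atTop) (𝓝 (V x t)) := by
  have hline : ∀ {A : ℂ → ℝ → ℂ} (j : ℕ), IsAmplitude {1, -1} M 0 A →
      IsAmplitude {1, -1} M (-(j : ℤ) + 0)
        (fun z t => ((1 + Complex.I * z)⁻¹) ^ j * evolve κ μ A z t) := fun j hA =>
    IsAmplitude.symbol_mul (isSymbol_inv_pow cone_line_subset_sector M j)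
      (hA.evolve disp_re_line κ μ)
  induction d generalizing j φ with
  | zero =>
    have hA := hline j (hφ.isAmplitude_hat_line M)
    refine ⟨_, hA.decaysUpTo (by simp) (by simp) (by simp) (by simp) le_rfl
      (weightIntegrable_of_im_eq_zero (by simp) (by lia))
      (weightIntegrable_of_im_eq_zero (by simp) (by lia)), fun x t hx ht => ?_⟩
    exact hA.tendsto_line (by lia) hx ht.le
  | succ d ih =>
    -- The induction handles the remaining transform, of `φ + ∂_y φ`; the boundary value goes to
    -- `Γ`.
    obtain ⟨V, hV, hVt⟩ := ih hφ.one_add_deriv (j + 1) (by lia)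
    have hG : IsAmplitude {rayR, rayL} M (-((j + 1 : ℕ) : ℤ) + 0)
        (fun z t => ((1 + Complex.I * z)⁻¹) ^ (j + 1) *
          evolve κ μ (fun _ τ => φ 0 0 0 τ) z t) :=
      IsAmplitude.symbol_mul (isSymbol_inv_pow cone_gamma_subset_sector M (j + 1))
        ((hφ.isAmplitude_trace M).evolve disp_re_gamma κ μ)
    refine ⟨_, hG.decaysUpTo_gamma.add hV, fun x t hx ht => ?_⟩
    refine ((tendsto_line_trace j hx ht.le ((hφ.continuousOn_time 0 0 le_rfl).mono
      Icc_subset_Ici_self)).add (hVt x t hx ht)).congr fun q => ?_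
    rw [← intervalIntegral.integral_add]
    · refine intervalIntegral.integral_congr fun s _ => ?_
      simp only [hφ.evolve_hat_eq s ht.le]
      ring
    · exact ((hline (j + 1) (hφ.isAmplitude_trace M)).continuous_line x
        ht.le).intervalIntegrable _ _
    · exact ((hline (j + 1) (hφ.one_add_deriv.isAmplitude_hat_line M)).continuous_line x
        ht.le).intervalIntegrable _ _

/-- The integral over `ℝ` of an evolved half-line transform converges, with rapid decay. -/
lemma IsDataFamily.exists_line (hφ : IsDataFamily φ) (κ μ : ℂ) (M : ℕ) :
    ∃ V : ℝ → ℝ → ℂ, DecaysUpTo M V ∧ ∀ x t : ℝ, 0 < x → 0 < t →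
      Tendsto (fun q : ℝ × ℝ => ∫ s in q.1..q.2, Complex.exp (Complex.I * s * x) *
        evolve κ μ (fun z τ => hat (fun y => φ 0 0 y τ) z) s t)
        (atBot ×ˢ atTop) (𝓝 (V x t)) := by
  simpa using hφ.exists_line_decay κ μ M (6 * M + 6) 0 (by lia)

/-! ### The five integrals -/

lemma kernel_mul (x t : ℝ) (z b : ℂ) :
    kernel x t z * b = Complex.exp (Complex.I * z * x) * (Complex.exp (-disp z * t) * b) := by
  rw [kernel, sub_eq_add_neg, Complex.exp_add, neg_mul, mul_assoc]

lemma initialLine_eq (u : ℝ → ℂ) (x t : ℝ) (z : ℂ) :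
    initialLine u x t z =
      Complex.exp (Complex.I * z * x) * evolve 1 0 (fun z _ => hat u z) z t := by
  rw [initialLine, kernel_mul, evolve_eq]
  ring

lemma initialGamma_eq (u : ℝ → ℂ) (x t : ℝ) (z : ℂ) :
    initialGamma u x t z = Complex.exp (Complex.I * z * x) *
      (alpha * evolve 1 0 (fun z _ => hat u (alpha * z)) z t +
        alpha ^ 2 * evolve 1 0 (fun z _ => hat u (alpha ^ 2 * z)) z t) := by
  rw [initialGamma, kernel_mul, evolve_eq, evolve_eq]
  ring

lemma boundaryGamma_eq (g : ℝ → ℂ) (x t : ℝ) (z : ℂ) :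
    boundaryGamma g x t z = Complex.exp (Complex.I * z * x) *
      (3 * z ^ 2 * evolve 0 1 (fun _ τ => g τ) z t) := by
  rw [boundaryGamma, kernel_mul, evolve_eq, gTilde]
  ring

lemma forcingLine_eq (f : ℝ → ℝ → ℂ) (x t : ℝ) (z : ℂ) :
    forcingLine f x t z = Complex.exp (Complex.I * z * x) *
      evolve 0 1 (fun z τ => hat (fun y => f y τ) z) z t := by
  rw [forcingLine, kernel_mul, evolve_eq, fTilde]
  ring

lemma forcingGamma_eq (f : ℝ → ℝ → ℂ) (x t : ℝ) (z : ℂ) :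
    forcingGamma f x t z = Complex.exp (Complex.I * z * x) *
      (alpha * evolve 0 1 (fun z τ => hat (fun y => f y τ) (alpha * z)) z t +
        alpha ^ 2 * evolve 0 1 (fun z τ => hat (fun y => f y τ) (alpha ^ 2 * z)) z t) := by
  rw [forcingGamma, kernel_mul, evolve_eq, evolve_eq, fTilde, fTilde]
  ring

lemma IsDataFamily.isAmplitude_gamma (hφ : IsDataFamily φ) (κ μ : ℂ) (n : ℕ) :
    IsAmplitude {rayR, rayL} n 0 (fun z t =>
      alpha * evolve κ μ (fun z τ => hat (fun y => φ 0 0 y τ) (alpha * z)) z t +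
        alpha ^ 2 * evolve κ μ (fun z τ => hat (fun y => φ 0 0 y τ) (alpha ^ 2 * z)) z t) :=
  (((hφ.isAmplitude_hat alpha_mul_im_nonpos n).evolve disp_re_gamma κ μ).const_mul alpha).add
    (((hφ.isAmplitude_hat alpha_sq_mul_im_nonpos n).evolve disp_re_gamma κ μ).const_mul (alpha ^ 2))

/-- Only bounded times matter, so smoothness of `g` on `[0, ∞)` suffices, with no decay. The growth
`z ^ 2` is harmless on `Γ`. -/
lemma isAmplitude_boundary {g : ℝ → ℂ} (hg : ContDiffOn ℝ ∞ g (Ici 0)) (n : ℕ) :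
    IsAmplitude {rayR, rayL} n (2 + 0)
      (fun z t => 3 * z ^ 2 * evolve 0 1 (fun _ τ => g τ) z t) := by
  have h1 : IsAmplitude {rayR, rayL} n 0 (fun _ t => iteratedDerivWithin 0 g (Ici 0) t) :=
    IsAmplitude.param (c := fun m => iteratedDerivWithin m g (Ici 0))
      (fun m => hg.continuousOn_iteratedDerivWithin (by exact_mod_cast le_top)
        (uniqueDiffOn_Ici 0))
      fun m t ht => ContDiffOn.hasDerivAt_iteratedDerivWithin_Ici hg m ht
  rw [iteratedDerivWithin_zero] at h1
  refine IsAmplitude.symbol_mul (a := fun z => 3 * z ^ 2) ?_ (h1.evolve disp_re_gamma 0 1)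
  exact ((IsSymbol.id.pow 2).const_mul 3).mono (by norm_num)

lemma IsDataFamily.convergesOnLine (hφ : IsDataFamily φ) (κ μ : ℂ) {x t : ℝ} (hx : 0 < x)
    (ht : 0 < t) :
    ConvergesOnLine (fun s => Complex.exp (Complex.I * s * x) *
      evolve κ μ (fun z τ => hat (fun y => φ 0 0 y τ) z) s t) := by
  -- For convergence alone, order `M = 0` is enough.
  obtain ⟨V, -, hV⟩ := hφ.exists_line κ μ 0
  exact ⟨(((hφ.isAmplitude_hat_line 0).evolve disp_re_line κ μ).continuous_line x
    ht.le).locallyIntegrable, V x t, hV x t hx ht⟩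

/-- The decomposition producing `V` depends on `M`, but its value is always the limit of the same
truncated integrals. One function thus satisfies the estimates of every order. -/
lemma IsDataFamily.decaysUpTo_line (hφ : IsDataFamily φ) (κ μ : ℂ) (M : ℕ) :
    DecaysUpTo M (fun x t => lineIntegral (fun s => Complex.exp (Complex.I * s * x) *
      evolve κ μ (fun z τ => hat (fun y => φ 0 0 y τ) z) s t)) := by
  obtain ⟨V, hV, hVt⟩ := hφ.exists_line κ μ M
  exact hV.congr fun x t hx ht => (hVt x t hx ht).limUnder_eq.symm

variable {u₀ g₀ : ℝ → ℂ} {f : ℝ → ℝ → ℂ}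

lemma utmConverges (hu₀ : IsSchwartzHalfLine u₀) (hg₀ : ContDiffOn ℝ ∞ g₀ (Ici 0))
    (hf : IsSchwartzForcing f) {x t : ℝ} (hx : 0 < x) (ht : 0 < t) :
    UTMConverges u₀ g₀ f x t := by
  obtain ⟨φ, hφ, hφu⟩ := hu₀.isSchwartzForcing.exists_dataFamily
  obtain ⟨ψ, hψ, rfl⟩ := hf.exists_dataFamily
  have h1 := hφ.convergesOnLine 1 0 hx ht
  have h2 := (hφ.isAmplitude_gamma 1 0 0).convergesOnGamma hx ht.le
  rw [hφu] at h1 h2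
  refine ⟨?_, ?_, ?_, ?_, ?_⟩
  · simpa only [initialLine_eq] using h1
  · rw [funext (initialGamma_eq u₀ x t)]
    exact h2
  · rw [funext (boundaryGamma_eq g₀ x t)]
    exact (isAmplitude_boundary hg₀ 0).convergesOnGamma hx ht.le
  · simpa only [forcingLine_eq] using hψ.convergesOnLine 0 1 hx ht
  · rw [funext (forcingGamma_eq (ψ 0 0) x t)]
    exact (hψ.isAmplitude_gamma 0 1 0).convergesOnGamma hx ht.le

lemma decaysUpTo_utmSolution (hu₀ : IsSchwartzHalfLine u₀) (hg₀ : ContDiffOn ℝ ∞ g₀ (Ici 0))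
    (hf : IsSchwartzForcing f) (M : ℕ) : DecaysUpTo M (utmSolution u₀ g₀ f) := by
  obtain ⟨φ, hφ, hφu⟩ := hu₀.isSchwartzForcing.exists_dataFamily
  obtain ⟨ψ, hψ, rfl⟩ := hf.exists_dataFamily
  have h1 := hφ.decaysUpTo_line 1 0 M
  have h2 := (hφ.isAmplitude_gamma 1 0 M).decaysUpTo_gamma
  rw [hφu] at h1 h2
  have h3 := ((isAmplitude_boundary hg₀ M).decaysUpTo_gamma).const_mul (-1)
  have h4 := hψ.decaysUpTo_line 0 1 M
  have h5 := (hψ.isAmplitude_gamma 0 1 M).decaysUpTo_gamma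
  refine (((((h1.add h2).add h3).add h4).add h5).const_mul (1 / (2 * Real.pi))).congr
    fun x t _ _ => ?_
  simp only [utmSolution, initialLine_eq, forcingLine_eq, funext (initialGamma_eq u₀ x t),
    funext (boundaryGamma_eq g₀ x t), funext (forcingGamma_eq (ψ 0 0) x t)]
  ring

end

end LinearKdV

theorem theorem1 (u₀ g₀ : ℝ → ℂ) (f : ℝ → ℝ → ℂ)
    (hu₀ : LinearKdV.IsSchwartzHalfLine u₀)
    (hg₀ : ContDiffOn ℝ ∞ g₀ (Set.Ici 0))
    (hf : LinearKdV.IsSchwartzForcing f) :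
    (∀ x t : ℝ, 0 < x → 0 < t → LinearKdV.UTMConverges u₀ g₀ f x t) ∧
    ContDiffOn ℝ ∞ (fun p : ℝ × ℝ => LinearKdV.utmSolution u₀ g₀ f p.1 p.2)
      (Set.Ioi 0 ×ˢ Set.Ioi 0) ∧
    ∀ T₀ : ℝ, 0 < T₀ → ∀ k m l : ℕ,
      TendstoUniformlyOn
        (fun x t : ℝ =>
          (x : ℂ) ^ l * LinearKdV.mixedDeriv k m (LinearKdV.utmSolution u₀ g₀ f) x t)
        (fun _ => 0) Filter.atTop (Set.Ioc 0 T₀) ∧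
      ∀ x₀ : ℝ, 0 < x₀ → ∃ C : ℝ, ∀ x t : ℝ, x₀ ≤ x → 0 < t → t ≤ T₀ →
        ‖(x : ℂ) ^ l * LinearKdV.mixedDeriv k m (LinearKdV.utmSolution u₀ g₀ f) x t‖ ≤ C := by
  have hU := LinearKdV.decaysUpTo_utmSolution hu₀ hg₀ hf
  refine ⟨fun x t hx ht => LinearKdV.utmConverges hu₀ hg₀ hf hx ht,
    contDiffOn_infty.2 fun M => (hU M).contDiffOn, fun T₀ hT₀ k m l => ⟨?_, fun x₀ hx₀ => ?_⟩⟩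
  -- The extra `1` pays for the additional power of `x` that turns boundedness into convergence to
  -- `0`.
  · exact (hU (k + m + l + 1)).mixedDeriv_tendsto (by lia) (by lia) (by lia) hT₀
  · exact (hU (k + m + l)).mixedDeriv_bound (by lia) (by lia) (by lia) hx₀ hT₀
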